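/- Let $k$ be a commutative ring in which $2$ is invertible, and let $\omega\in k$ satisfy $\omega^2=-1$ or $\omega=1$. A disoriented $1$- or $2$-manifold is a piecewise oriented manifold in which every interface between differently oriented regions (a mark on a curve, a seam on a surface) carries a preferred normal direction (fringe). Let $\mathcal D$ be the $k$-linear category whose objects are crossingless disoriented tangles $q^mA$ with formal grading shifts, with three incoming and three outgoing end points, and whose morphisms are the $k$-linear combinations of abstract disoriented cobordisms of degree $0$ (where $C:q^mA\to q^nB$ has degree $\chi(C)-3+n-m$), up to homeomorphism rel boundary, modulo the local relations: away from the seams, sphere $=0$, torus $=2$ and neck cutting (a cylinder is $\tfrac12$ of the sum of the two surfaces obtained by cutting it, capping with two discs, and adding a handle to one of the discs); and, for the seams, a circular seam bounding a disc, with inward (outward) fringe, can be removed at the cost of a factor $\omega$ ($\omega^{-1}$), and two parallel seam arcs with fringes pointing towards each other equal $\omega^{-1}$ times the recoupled arcs, with fringes pointing away from each other. To a tangle diagram with ordered positive crossings $1,\dots,n$ assign the cube complex over the additive closure of $\mathcal D$: it is the tensor product of the complexes $$q\,(\text{oriented smoothing})\to q^2\,(\text{disoriented smoothing})$$ of the crossings,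 in homological heights $0$ and $1$. The disorientation marks of the disoriented smoothing point to the right relative to the direction of the crossing, the differential is the saddle whose seam joins the two marks, and the saddle at crossing $i$ gets the sign $(-1)^{\#\{j>i\,:\,\text{crossing } j\text{ is smoothed in the disoriented way}\}}$. Write $L_{abc}$, $R_{abc}$ for the smoothings of the two diagrams below, with $a,b,c\in\{0,1\}$ ($0$ oriented, $1$ disoriented) for the crossings $1,2,3$. Consider the braidlike Reidemeister move $R3_{hml}$ on three strands, all drawn upwards, in which the high strand runs from bottom left to top right, the low strand from bottom right to top left, and the middle strand stays in the middle (all crossings are positive). In the initial diagram $L$ the triangle is to the left of the low strand, and the crossings are ordered: high/low, middle/low, high/middle. In the final diagram $R$ it is to the right, and they are ordered: middle/low, high/low, high/middle. **Proposition.** The assignments of the two cubes (with $8$ objects and $4$ homological heights each) are complexes, and the following is a chain map and a homotopy equivalence from the complex of $L$ to the complex of $R$. Its nonzero components are - the identities $L_{000}\to R_{000}$, $L_{100}\to R_{100}$, $L_{010}\to R_{010}$, $L_{110}\to R_{110}$; - the identity $L_{100}\to R_{001}$, and $\omega^2c_5:L_{110}\to R_{101}$; - $-\omega^2c_6:L_{101}\to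 R_{101}$, $\ \omega^2\,ms:L_{011}\to R_{101}$, $\ -\mathrm{Id}:L_{101}\to R_{011}$, $\ c_1:L_{011}\to R_{011}$. Here the objects of the two cubes joined by identities are identified as the same disoriented planar diagrams. Each of $c_1,c_5,c_6$ is a disjoint union of a disc bounding the circle in its source or target, a curtain (a product), and a saddle; $c_1$ caps off the circle of $L_{011}$, while $c_5$ and $c_6$ create the circle of $R_{101}$. The cobordism $ms$ caps off the circle of $L_{011}$, creates the circle of $R_{101}$, and is a monkey saddle (a disc bounded by the remaining arcs) elsewhere. All components of these surfaces are discs, carrying the unique configuration of seams, up to isotopy, without closed seams. The homotopy equivalence, its inverse and the homotopies consist of morphisms of degree $0$. -/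

import Mathlib

open CategoryTheory

/-! # Disoriented surfaces, disoriented smoothings and the cube of a positive tangle diagram

Compact surfaces are presented in the classical way, by finitely many polygons whose sides are
glued in pairs.  A *disoriented* surface is a piecewise oriented surface in which every curve
separating differently oriented regions (a *seam*) carries a preferred normal direction (its
*fringe*).  In a polygonal presentation every polygon is oriented, namely by the order in which
its sides are listed, and the seams run along edges. -/

namespace Disoriented

/-! ## Polygonal presentations -/

/-- A side of one of the oriented polygons.

* `src e`: a boundary side lying on the edge `e` of the source 1-manifold; the orientation of
  the polygon traverses it against the orientation of `e`.
* `tgt e`: a boundary side lying on the edge `e` of the target 1-manifold; it is traversed along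
  the orientation of `e`.
* `fwd x`, `bwd x`: the two sides glued along an ordinary interior edge `x`; they are traversed
  in opposite directions, so that the orientations of the two polygons agree across `x`.
* `head y`, `tail y`: the two sides glued along a seam edge `y`; both are traversed in the same
  direction, so that the orientations disagree across `y`.  The fringe of the seam points from
  the polygon containing `tail y` into the polygon containing `head y`. -/
inductive Side where
  | src (e : ℕ)
  | tgt (e : ℕ)
  | fwd (x : ℕ)
  | bwd (x : ℕ)
  | head (y : ℕ)
  | tail (y : ℕ)
  deriving DecidableEq

open Side

/-- The polygons of a presentation; each is the cyclic list of its sides. -/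
abbrev Polygons := List (List Side)

/-- An end point of a side: `(s, false)` is the initial point and `(s, true)` the final point of
`s` in the traversal of its polygon. -/
abbrev Germ := Side × Bool

/-- The side glued to a given side; `none` for boundary sides. -/
def mate : Side → Option Side
  | src _ => none
  | tgt _ => none
  | fwd x => some (bwd x)
  | bwd x => some (fwd x)
  | head y => some (tail y)
  | tail y => some (head y)

/-- The end point of the mate to which an end point of an interior side is glued. -/
def cross : Germ → Option Germ
  | (fwd x, b) => some (bwd x, !b)
  | (bwd x, b) => some (fwd x, !b)
  | (head y, b) => some (tail y, b)
  | (tail y, b) => some (head y, b)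
  | (src _, _) => none
  | (tgt _, _) => none

/-- All pairs (side, next side) in the polygons. -/
def successors (W : Polygons) : List (Side × Side) :=
  W.flatMap fun w => w.zip (w.drop 1 ++ w.take 1)

/-- The other side meeting `g` in the same corner of the polygon. -/
def corner (W : Polygons) : Germ → Germ
  | (s, true) => (((successors W).lookup s).getD s, false)
  | (s, false) => ((((successors W).map Prod.swap).lookup s).getD s, true)

/-- Walk around the end point `g` of a side, starting into the polygon of that side and passing
through ordinary interior edges, until the first seam edge or boundary edge is reached.
(The first argument bounds the number of corners passed.) -/
def sectorAux (W : Polygons) : ℕ → Germ → Germ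
  | 0, g => g
  | n + 1, g =>
    match corner W g with
    | (fwd x, b) => sectorAux W n (bwd x, !b)
    | (bwd x, b) => sectorAux W n (fwd x, !b)
    | g' => g'

/-- The far boundary of the sector (at a vertex, between consecutive seam or boundary edges) whose
near boundary is `g`. -/
def sector (W : Polygons) (g : Germ) : Germ := sectorAux W W.flatten.length g

/-- Going once around an interior vertex, starting by entering a polygon at `g`: the list of germs
at which polygons are entered.  The value is `none` if one runs into the boundary. -/
def orbitAux (W : Polygons) (start : Germ) : ℕ → Germ → Option (List Germ)
  | 0, _ => none
  | n + 1, g =>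
    match cross (corner W g) with
    | none => none
    | some g' => if g' = start then some [g'] else (orbitAux W start n g').map (g' :: ·)

/-- The germs of all sides. -/
def germs (W : Polygons) : List Germ := W.flatten.flatMap fun s => [(s, false), (s, true)]

/-- The number of closed walks around vertices.  Every interior vertex is encircled by exactly
two of them, one for each sense of rotation. -/
def closedWalks (W : Polygons) : ℕ :=
  ((germs W).foldl (fun (acc : List Germ × ℕ) g =>
    if g ∈ acc.1 then acc else
      match orbitAux W g (germs W).length g with
      | none => acc
      | some c => (c ++ acc.1, acc.2 + 1)) ([], 0)).2

/-- Is this side one of `fwd x`, `head y`?  There is one such side for every interior edge. -/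
def isLeading : Side → Bool
  | fwd _ => true
  | head _ => true
  | _ => false

/-- Twice the Euler characteristic of the surface.  The boundary consists of circles, so that only
faces, interior edges and interior vertices contribute. -/
def twiceEuler (W : Polygons) : ℤ :=
  2 * (W.length : ℤ) - 2 * ((W.flatten.filter isLeading).length : ℤ) + (closedWalks W : ℤ)

/-! ## Disoriented 1-manifolds -/

/-- A crossingless disoriented tangle with `p` incoming and `q` outgoing end points: a compact
piecewise oriented 1-manifold, cut into oriented edges `0, 1, …, edges - 1`, in which every
interface between differently oriented pieces (a *disorientation mark*) has a preferred normal
direction.  Only the underlying abstract 1-manifold is recorded, since cobordisms are abstract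
surfaces.  The ends of the edges meet as follows.

* `plain`: `(e, f)` means that the final point of `e` is the initial point of `f`.
* `heads`: `(e, f)` means that the final points of `e` and `f` form a disorientation mark whose
  normal direction points from `e` to `f`.
* `tails`: `(e, f)` means that the initial points of `e` and `f` form a disorientation mark whose
  normal direction points from `e` to `f`.
* `ins`: the edges which start at the incoming end points, in order.
* `outs`: the edges which finish at the outgoing end points, in order. -/
structure DisTangle (p q : ℕ) where
  edges : ℕ
  plain : List (ℕ × ℕ)
  heads : List (ℕ × ℕ)
  tails : List (ℕ × ℕ)
  ins : List ℕ
  outs : List ℕ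
  ins_length : ins.length = p
  outs_length : outs.length = q
  final_perm : (plain.map Prod.fst ++ (heads.map Prod.fst ++ heads.map Prod.snd) ++ outs).Perm
    (List.range edges)
  initial_perm : (plain.map Prod.snd ++ (tails.map Prod.fst ++ tails.map Prod.snd) ++ ins).Perm
    (List.range edges)

variable {p q : ℕ}

/-! ## Disoriented cobordisms -/

/-- Is this side a boundary side? -/
def onBoundary (s : Side) : Bool := (mate s).isNone

/-- The side is allowed in a cobordism from `A` to `B`, and if it is an interior side then its
mate occurs as well. -/
def sideOK (A B : DisTangle p q) (W : Polygons) : Side → Bool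
  | src e => decide (e < A.edges)
  | tgt e => decide (e < B.edges)
  | fwd x => decide (bwd x ∈ W.flatten)
  | bwd x => decide (fwd x ∈ W.flatten)
  | head y => decide (tail y ∈ W.flatten)
  | tail y => decide (head y ∈ W.flatten)

/-- `g` and `h` are the two sides of one and the same seam end, with the fringe pointing from the
side of `g` to the side of `h`. -/
def isSeamEnd : Germ → Germ → Bool
  | (tail y, b), (head y', b') => decide (y = y' ∧ b = b')
  | _, _ => false

/-- At a boundary vertex with the two boundary edge ends `g`, `h`, exactly one seam ends, and its
fringe points from `g` to `h`. -/
def markAt (W : Polygons) (g h : Germ) : Bool := isSeamEnd (sector W g) (sector W h)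

/-- Both ends of the seam edge `y` are fine: each is either at a disorientation mark on the
boundary, or the seam is continued by exactly one further seam end, with a matching fringe. -/
def seamOK (W : Polygons) (y : ℕ) : Bool :=
  [false, true].all fun b =>
    (onBoundary (sector W (tail y, b)).1 && onBoundary (sector W (head y, b)).1) ||
      isSeamEnd (sector W (tail y, b)) (sector W (head y, b))

/-- The polygons `W` present a disoriented surface whose boundary is the union of the source `A`
and the target `B`, which meet in their end points (the product `end points × interval` in the
boundary of a cobordism is collapsed to the end points). -/
def IsCobordism (A B : DisTangle p q) (W : Polygons) : Prop :=
  -- polygons have at least one side, and every side occurs once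
  (∀ w ∈ W, w ≠ []) ∧ W.flatten.Nodup ∧ (∀ s ∈ W.flatten, sideOK A B W s = true) ∧
  (∀ e ∈ List.range A.edges, src e ∈ W.flatten) ∧
  (∀ e ∈ List.range B.edges, tgt e ∈ W.flatten) ∧
  -- no seam ends where the orientations of adjacent boundary edges agree
  (∀ t ∈ A.plain, sector W (src t.1, false) = (src t.2, true)) ∧
  (∀ t ∈ B.plain, sector W (tgt t.1, true) = (tgt t.2, false)) ∧
  (∀ t ∈ A.ins.zip B.ins, sector W (src t.1, true) = (tgt t.2, false)) ∧
  (∀ t ∈ A.outs.zip B.outs, sector W (src t.1, false) = (tgt t.2, true)) ∧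
  -- exactly one seam ends at each disorientation mark, its fringe being the given normal direction
  (∀ t ∈ A.heads, markAt W (src t.1, false) (src t.2, false) = true) ∧
  (∀ t ∈ A.tails, markAt W (src t.1, true) (src t.2, true) = true) ∧
  (∀ t ∈ B.heads, markAt W (tgt t.1, true) (tgt t.2, true) = true) ∧
  (∀ t ∈ B.tails, markAt W (tgt t.1, false) (tgt t.2, false) = true) ∧
  -- seams form a properly embedded 1-manifold
  (∀ s ∈ W.flatten, ∀ y ∈ (match s with | head y => some y | _ => none : Option ℕ),
    seamOK W y = true)

instance (A B : DisTangle p q) (W : Polygons) : Decidable (IsCobordism A B W) := by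
  unfold IsCobordism
  infer_instance

/-- A crossingless disoriented tangle with a formal grading shift `q ^ shift`. -/
structure GrTangle (p q : ℕ) where
  tangle : DisTangle p q
  shift : ℤ

/-- A disoriented cobordism of degree `0` between graded objects, where the degree of a surface
`C : q ^ m A ⟶ q ^ n B` with `k` boundary points is `χ(C) - k / 2 + n - m`. -/
structure Cob (X Y : GrTangle p q) where
  polygons : Polygons
  isCobordism : IsCobordism X.tangle Y.tangle polygons
  degree : twiceEuler polygons - ((p : ℤ) + q) + 2 * (Y.shift - X.shift) = 0

instance : Quiver (GrTangle p q) := ⟨Cob⟩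

/-! ### Changes of the presentation -/

/-- Rename the ordinary interior edges by `f` and the seam edges by `g`. -/
def Side.relabel (f g : ℕ → ℕ) : Side → Side
  | src e => src e
  | tgt e => tgt e
  | fwd x => fwd (f x)
  | bwd x => bwd (f x)
  | head y => head (g y)
  | tail y => tail (g y)

/-- Reverse the naming direction of the ordinary interior edge `x`. -/
def Side.turn (x : ℕ) : Side → Side
  | fwd z => if z = x then bwd z else fwd z
  | bwd z => if z = x then fwd z else bwd z
  | s => s

/-- Subdivide the ordinary interior edge `x` into `x` followed by `z`. -/
def Side.subdivide (x z : ℕ) : Side → List Side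
  | fwd t => if t = x then [fwd x, fwd z] else [fwd t]
  | bwd t => if t = x then [bwd z, bwd x] else [bwd t]
  | s => [s]

/-- Subdivide the seam edge `y` into `y` followed by `z`. -/
def Side.subdivideSeam (y z : ℕ) : Side → List Side
  | head t => if t = y then [head y, head z] else [head t]
  | tail t => if t = y then [tail y, tail z] else [tail t]
  | s => [s]

/-- The elementary changes of a polygonal presentation, which do not change the disoriented surface
up to homeomorphism relative to its boundary. -/
inductive Move : Polygons → Polygons → Prop
  /-- reorder the polygons -/
  | reorder {W W' : Polygons} : W.Perm W' → Move W W'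
  /-- start listing the sides of a polygon at another side -/
  | rotate (u v : List Side) (W : Polygons) : Move ((u ++ v) :: W) ((v ++ u) :: W)
  /-- rename interior edges -/
  | relabel (f g : Equiv.Perm ℕ) (W : Polygons) : Move W (W.map (List.map (Side.relabel f g)))
  /-- reverse the direction used to name an ordinary interior edge -/
  | turn (x : ℕ) (W : Polygons) : Move W (W.map (List.map (Side.turn x)))
  /-- subdivide an ordinary interior edge -/
  | subdivide (x z : ℕ) (W : Polygons) : fwd z ∉ W.flatten → bwd z ∉ W.flatten →
      Move W (W.map (List.flatMap (Side.subdivide x z)))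
  /-- subdivide a seam edge -/
  | subdivideSeam (y z : ℕ) (W : Polygons) : head z ∉ W.flatten → tail z ∉ W.flatten →
      Move W (W.map (List.flatMap (Side.subdivideSeam y z)))
  /-- paste two polygons along an ordinary interior edge (and, conversely, cut a polygon) -/
  | paste (x : ℕ) (u v : List Side) (W : Polygons) : u ++ v ≠ [] →
      fwd x ∉ ((u ++ v) :: W).flatten → bwd x ∉ ((u ++ v) :: W).flatten →
      Move ((u ++ [fwd x]) :: (bwd x :: v) :: W) ((u ++ v) :: W)
  /-- fold two adjacent sides together -/
  | fold (x : ℕ) (u : List Side) (W : Polygons) : u ≠ [] →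
      fwd x ∉ (u :: W).flatten → bwd x ∉ (u :: W).flatten →
      Move ((fwd x :: bwd x :: u) :: W) (u :: W)

/-- Two presentations are equivalent if they are related by elementary changes. -/
def Equivalent (W W' : Polygons) : Prop := Relation.EqvGen Move W W'

/-! ### Composition and identities -/

/-- Renaming of the sides of the first factor of a composition. -/
def Side.first : Side → Side
  | src e => src e
  | tgt e => fwd (3 * e)
  | fwd x => fwd (3 * x + 1)
  | bwd x => bwd (3 * x + 1)
  | head y => head (2 * y)
  | tail y => tail (2 * y)

/-- Renaming of the sides of the second factor of a composition. -/
def Side.second : Side → Side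
  | src e => bwd (3 * e)
  | tgt e => tgt e
  | fwd x => fwd (3 * x + 2)
  | bwd x => bwd (3 * x + 2)
  | head y => head (2 * y + 1)
  | tail y => tail (2 * y + 1)

/-- The union of two surfaces, glued along the edges of the target of the first one, which is the
source of the second one; these become ordinary interior edges. -/
def glue (W W' : Polygons) : Polygons :=
  W.map (List.map Side.first) ++ W'.map (List.map Side.second)

/-- The strip `e × interval` over an edge of `A`, whose vertical sides are glued to those of the
adjacent strips: ordinarily over a vertex where the orientations of the two edges agree, and along a
seam over a disorientation mark. -/
def strip (A : DisTangle p q) (e : ℕ) : List Side :=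
  [src e] ++
  (A.plain.zipIdx.flatMap fun t => if t.1.2 = e then [fwd t.2] else []) ++
  (A.tails.zipIdx.flatMap fun t =>
    (if t.1.1 = e then [tail (2 * t.2)] else []) ++ (if t.1.2 = e then [head (2 * t.2)] else [])) ++
  [tgt e] ++
  (A.plain.zipIdx.flatMap fun t => if t.1.1 = e then [bwd t.2] else []) ++
  (A.heads.zipIdx.flatMap fun t =>
    (if t.1.1 = e then [tail (2 * t.2 + 1)] else []) ++
    (if t.1.2 = e then [head (2 * t.2 + 1)] else []))

/-- The product surface `A × interval`. -/
def cylinder (A : DisTangle p q) : Polygons := (List.range A.edges).map (strip A)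

/-! ## The category of disoriented abstract cobordisms modulo local relations -/

/-- Formal `k`-linear combinations of formal composites (paths) of disoriented cobordisms. -/
abbrev FreeCob (k : Type*) [CommRing k] (p q : ℕ) := Free k (Paths (GrTangle p q))

/-- A single surface, as a morphism of `FreeCob`. -/
noncomputable def surf (k : Type*) [CommRing k] {X Y : GrTangle p q} (S : Cob X Y) :
    (Free.embedding k _).obj ((Paths.of (GrTangle p q)).obj X) ⟶
      (Free.embedding k _).obj ((Paths.of (GrTangle p q)).obj Y) :=
  (Free.embedding k _).map ((Paths.of (GrTangle p q)).map (X := X) (Y := Y) S)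

/-- The boundary word of a punctured torus. -/
def handle (x y : ℕ) : List Side := [fwd x, fwd y, bwd x, bwd y]

/-- Outside a disc that is bounded by the seam `y` and whose orientation gets reversed, the seam
becomes the ordinary edge `x`. -/
def Side.unseam (y x : ℕ) : Side → Side
  | head z => if z = y then fwd x else head z
  | tail z => if z = y then fwd x else tail z
  | s => s

/-- The replacement of the sides outside a rectangle whose orientation gets reversed: the seams
`y₁`, `y₂` become ordinary edges `x₁`, `x₂` and the ordinary edges `a₁`, `a₂` become seams
`z₁`, `z₂` with fringes pointing out of the rectangle. -/
def Side.recouple (y₁ y₂ a₁ a₂ x₁ x₂ z₁ z₂ : ℕ) : Side → Side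
  | tail y => if y = y₁ then fwd x₁ else if y = y₂ then fwd x₂ else tail y
  | bwd a => if a = a₁ then head z₁ else if a = a₂ then head z₂ else bwd a
  | s => s

/-- The defining relations. -/
inductive Relations (k : Type*) [CommRing k] [Invertible (2 : k)] (ω : kˣ) (p q : ℕ) :
    HomRel (FreeCob k p q)
  /-- Surfaces are considered up to homeomorphism relative to the boundary. -/
  | homeo {X Y : GrTangle p q} (S T : Cob X Y) : Equivalent S.polygons T.polygons →
      Relations k ω p q (surf k S) (surf k T)
  /-- Composition is gluing. -/
  | comp {X Y Z : GrTangle p q} (S : Cob X Y) (T : Cob Y Z) (U : Cob X Z) :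
      U.polygons = glue S.polygons T.polygons →
      Relations k ω p q (surf k S ≫ surf k T) (surf k U)
  /-- Identities are products. -/
  | one {X : GrTangle p q} (S : Cob X X) : S.polygons = cylinder X.tangle →
      Relations k ω p q (surf k S) (𝟙 _)
  /-- A surface with a spherical component is zero. -/
  | sphere {X Y : GrTangle p q} (S : Cob X Y) (x : ℕ) (W : Polygons) :
      S.polygons = [fwd x, bwd x] :: W → Relations k ω p q (surf k S) 0
  /-- A torus component can be replaced by a factor `2`. -/
  | torus {X Y : GrTangle p q} (S T : Cob X Y) (x y : ℕ) :
      S.polygons = handle x y :: T.polygons →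
      Relations k ω p q (surf k S) ((2 : k) • surf k T)
  /-- Neck cutting: a neck (here, the annulus around the closed curve which runs through the polygon
  from one of the sides `fwd x`, `bwd x` to the other one) is replaced by two discs,
  and by half the sum of the two ways of adding a handle to one of these. -/
  | neck {X Y : GrTangle p q} (S T T' : Cob X Y) (x y : ℕ) (u v : List Side) (W : Polygons) :
      u ≠ [] → v ≠ [] → S.polygons = ((fwd x :: u) ++ (bwd x :: v)) :: W →
      T.polygons = (u ++ handle x y) :: v :: W → T'.polygons = u :: (v ++ handle x y) :: W →
      Relations k ω p q (surf k S) (⅟(2 : k) • (surf k T + surf k T'))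
  /-- A circular seam bounding a disc, with inward fringe, is a factor `ω`. -/
  | inward {X Y : GrTangle p q} (S T : Cob X Y) (x y : ℕ) (W : Polygons) :
      S.polygons = [head y] :: W →
      T.polygons = [bwd x] :: W.map (List.map (Side.unseam y x)) →
      Relations k ω p q (surf k S) ((ω : k) • surf k T)
  /-- A circular seam bounding a disc, with outward fringe, is a factor `ω⁻¹`. -/
  | outward {X Y : GrTangle p q} (S T : Cob X Y) (x y : ℕ) (W : Polygons) :
      S.polygons = [tail y] :: W →
      T.polygons = [bwd x] :: W.map (List.map (Side.unseam y x)) →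
      Relations k ω p q (surf k S) (((ω⁻¹ : kˣ) : k) • surf k T)
  /-- Two parallel seams with their fringes pointing towards each other, on opposite sides of a
  rectangle, are `ω⁻¹` times the recoupled seams on the other two sides, with their
  fringes pointing away from each other. -/
  | parallel {X Y : GrTangle p q} (S T : Cob X Y) (y₁ y₂ a₁ a₂ x₁ x₂ z₁ z₂ : ℕ) (W : Polygons) :
      S.polygons = [head y₁, fwd a₁, head y₂, fwd a₂] :: W →
      T.polygons = [tail z₂, bwd x₂, tail z₁, bwd x₁] ::
        W.map (List.map (Side.recouple y₁ y₂ a₁ a₂ x₁ x₂ z₁ z₂)) →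
      Relations k ω p q (surf k S) (((ω⁻¹ : kˣ) : k) • surf k T)

/-- The smallest `k`-linear congruence containing a given relation. -/
inductive LinearClosure (k : Type*) [CommRing k] {C : Type*} [Category C] [Preadditive C]
    [Linear k C] (r : HomRel C) : HomRel C
  | of {X Y : C} {f g : X ⟶ Y} : r f g → LinearClosure k r f g
  | refl {X Y : C} (f : X ⟶ Y) : LinearClosure k r f f
  | symm {X Y : C} {f g : X ⟶ Y} : LinearClosure k r f g → LinearClosure k r g f
  | trans {X Y : C} {f g h : X ⟶ Y} :
      LinearClosure k r f g → LinearClosure k r g h → LinearClosure k r f h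
  | add {X Y : C} {f g f' g' : X ⟶ Y} :
      LinearClosure k r f g → LinearClosure k r f' g' → LinearClosure k r (f + f') (g + g')
  | smul {X Y : C} {f g : X ⟶ Y} (a : k) :
      LinearClosure k r f g → LinearClosure k r (a • f) (a • g)
  | comp_left {X Y Z : C} (f : X ⟶ Y) {g g' : Y ⟶ Z} :
      LinearClosure k r g g' → LinearClosure k r (f ≫ g) (f ≫ g')
  | comp_right {X Y Z : C} {f f' : X ⟶ Y} (g : Y ⟶ Z) :
      LinearClosure k r f f' → LinearClosure k r (f ≫ g) (f' ≫ g)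

instance (k : Type*) [CommRing k] {C : Type*} [Category C] [Preadditive C] [Linear k C]
    (r : HomRel C) : Congruence (LinearClosure k r) where
  comp_left f _ _ h := LinearClosure.comp_left f h
  comp_right g h := LinearClosure.comp_right g h
  equivalence := ⟨LinearClosure.refl, LinearClosure.symm, LinearClosure.trans⟩

/-- The congruence generated by the defining relations. -/
abbrev rel (k : Type*) [CommRing k] [Invertible (2 : k)] (ω : kˣ) (p q : ℕ) :
    HomRel (FreeCob k p q) := LinearClosure k (Relations k ω p q)

/-- The category of graded crossingless disoriented tangles with `p` incoming and `q` outgoing end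
points, and `k`-linear combinations of abstract disoriented cobordisms of degree `0`, modulo
the local relations. -/
abbrev DisAb (k : Type*) [CommRing k] [Invertible (2 : k)] (ω : kˣ) (p q : ℕ) :=
  Quotient (rel k ω p q)

variable {k : Type*} [CommRing k] [Invertible (2 : k)] {ω : kˣ}

noncomputable instance : Preadditive (DisAb k ω p q) :=
  Quotient.preadditive _ fun _ _ _ _ _ _ h h' => LinearClosure.add h h'

instance : (Quotient.functor (rel k ω p q)).Additive :=
  Quotient.functor_additive _ fun _ _ _ _ _ _ h h' => LinearClosure.add h h'

noncomputable instance : Linear k (DisAb k ω p q) :=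
  Quotient.linear k _ fun a _ _ _ _ h => LinearClosure.smul a h

/-- An object of `DisAb`. -/
noncomputable def toDisAb (k : Type*) [CommRing k] [Invertible (2 : k)] (ω : kˣ) (X : GrTangle p q) :
    DisAb k ω p q :=
  (Quotient.functor (rel k ω p q)).obj
    ((Free.embedding k _).obj ((Paths.of (GrTangle p q)).obj X))

/-- The morphism of `DisAb` given by a disoriented cobordism. -/
noncomputable def ofCob (k : Type*) [CommRing k] [Invertible (2 : k)] (ω : kˣ) {X Y : GrTangle p q}
    (S : Cob X Y) : toDisAb k ω X ⟶ toDisAb k ω Y :=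
  (Quotient.functor (rel k ω p q)).map (surf k S)

/-! ## Positive tangle diagrams and their cubes of resolutions -/

/-- The four arcs at a crossing, both strands being drawn upwards: incoming left and right, and
outgoing left and right. -/
structure Crossing where
  inL : ℕ
  inR : ℕ
  outL : ℕ
  outR : ℕ

/-- A resolution of `n` crossings: `false` is the oriented smoothing, `true` the disoriented one. -/
abbrev Resolution (n : ℕ) := Fin n → Bool

/-- The number of crossings resolved in the disoriented way. -/
def Resolution.weight {n : ℕ} (v : Resolution n) : ℕ := (Finset.univ.filter fun i => v i).card

/-- The ways in which a cobordism can look near a crossing: the product of an interval with the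
oriented or with the disoriented smoothing, or the saddle from the first to the second. -/
inductive Local where
  | oriented
  | disoriented
  | saddle

/-- A planar diagram, all of whose crossings are positive, of an oriented tangle with `p` incoming
and `q` outgoing end points and with `n` ordered crossings, given by the incidences of its oriented
arcs: every arc starts either at an incoming end point or by leaving a crossing, and it finishes
either at an outgoing end point or by entering a crossing. -/
structure Diagram (p q n : ℕ) where
  arcs : ℕ
  crossing : Fin n → Crossing
  ins : List ℕ
  outs : List ℕ
  ins_length : ins.length = p
  outs_length : outs.length = q
  final_perm : (((List.finRange n).flatMap fun i => [(crossing i).inL, (crossing i).inR]) ++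
    outs).Perm (List.range arcs)
  initial_perm : (((List.finRange n).flatMap fun i => [(crossing i).outL, (crossing i).outR]) ++
    ins).Perm (List.range arcs)

namespace Diagram

variable {n : ℕ} (D : Diagram p q n)

/-- The pairs of arcs joined by oriented smoothings. -/
def plain (v : Resolution n) : List (ℕ × ℕ) :=
  (List.finRange n).flatMap fun i =>
    if v i then [] else
      [((D.crossing i).inL, (D.crossing i).outL), ((D.crossing i).inR, (D.crossing i).outR)]

/-- The disorientation marks between the two incoming arcs of a crossing, which point to the
right. -/
def heads (v : Resolution n) : List (ℕ × ℕ) :=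
  (List.finRange n).flatMap fun i =>
    if v i then [((D.crossing i).inL, (D.crossing i).inR)] else []

/-- The disorientation marks between the two outgoing arcs of a crossing, which point to the
right. -/
def tails (v : Resolution n) : List (ℕ × ℕ) :=
  (List.finRange n).flatMap fun i =>
    if v i then [((D.crossing i).outL, (D.crossing i).outR)] else []

theorem smoothing_perm {α : Type*} [DecidableEq α] (l : List (Fin n)) (v : Resolution n)
    (a b c d : Fin n → α) (r : List α) (g : α × α → α)
    (h : ∀ i, g (a i, c i) = a i ∧ g (b i, d i) = b i) :
    ((l.flatMap fun i => if v i then [] else [(a i, c i), (b i, d i)]).map g ++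
      ((l.flatMap fun i => if v i then [(a i, b i)] else []).map Prod.fst ++
        (l.flatMap fun i => if v i then [(a i, b i)] else []).map Prod.snd) ++ r).Perm
    ((l.flatMap fun i => [a i, b i]) ++ r) := by
  refine List.Perm.append_right r ?_
  rw [List.perm_iff_count]
  intro x
  induction l with
  | nil => simp
  | cons i l ih =>
    simp only [List.flatMap_cons, List.map_append, List.count_append] at ih ⊢
    rw [← ih]
    cases v i <;> simp [h, List.count_cons] <;> omega

/-- The crossingless disoriented tangle obtained by smoothing all crossings. -/
def smoothing (v : Resolution n) : DisTangle p q where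
  edges := D.arcs
  plain := D.plain v
  heads := D.heads v
  tails := D.tails v
  ins := D.ins
  outs := D.outs
  ins_length := D.ins_length
  outs_length := D.outs_length
  final_perm := (smoothing_perm _ v _ _ _ _ _ Prod.fst fun _ => ⟨rfl, rfl⟩).trans D.final_perm
  initial_perm := by
    refine List.Perm.trans ?_ D.initial_perm
    have := smoothing_perm (List.finRange n) v (fun i => (D.crossing i).outL)
      (fun i => (D.crossing i).outR) (fun i => (D.crossing i).inL) (fun i => (D.crossing i).inR)
      D.ins (fun t => t.1) fun _ => ⟨rfl, rfl⟩
    refine List.Perm.trans (List.Perm.of_eq ?_) this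
    congr 2
    simp only [plain, List.map_flatMap]
    congr 1
    funext i
    cases v i <;> simp

/-- The smoothing with its grading shift: each crossing contributes `q` if it is resolved in the
oriented way and `q ^ 2` otherwise. -/
def vertex (v : Resolution n) : GrTangle p q := ⟨D.smoothing v, (n : ℤ) + v.weight⟩

/-- The behaviour at each crossing of the saddle at the crossing `c` of the smoothing `v`. -/
def localType (v : Resolution n) (c i : Fin n) : Local :=
  if i = c then .saddle else if v i then .disoriented else .oriented

/-- The surface which is a saddle near the crossing `c` and a product elsewhere.  Over each arc
there is a strip.  Away from `c` the vertical sides of the strips are glued as in a product.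
Near `c`, the vertical sides of the four adjacent strips bound a quadrilateral (with vertices the
two points of the oriented smoothing and the two marks of the disoriented smoothing); it consists
of two triangles glued along a seam joining the two marks, with fringe pointing to the right. -/
def saddlePolygons (v : Resolution n) (c : Fin n) : Polygons :=
  ((List.range D.arcs).map fun a =>
    [src a] ++
    ((List.finRange n).flatMap fun i =>
      (if (D.crossing i).outL = a then
        match localType v c i with
        | .oriented => [fwd (4 * i)]
        | .disoriented => [tail (2 * i + 1)]
        | .saddle => [fwd (4 * i + 2)] else []) ++
      (if (D.crossing i).outR = a then
        match localType v c i with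
        | .oriented => [fwd (4 * i + 1)]
        | .disoriented => [head (2 * i + 1)]
        | .saddle => [fwd (4 * i + 3)] else [])) ++
    [tgt a] ++
    ((List.finRange n).flatMap fun i =>
      (if (D.crossing i).inL = a then
        match localType v c i with
        | .oriented => [bwd (4 * i)]
        | .disoriented => [tail (2 * i)]
        | .saddle => [bwd (4 * i)] else []) ++
      (if (D.crossing i).inR = a then
        match localType v c i with
        | .oriented => [bwd (4 * i + 1)]
        | .disoriented => [head (2 * i)]
        | .saddle => [bwd (4 * i + 1)] else []))) ++
  [[tail (2 * c), bwd (4 * c + 2), fwd (4 * c)], [head (2 * c), bwd (4 * c + 3), fwd (4 * c + 1)]]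

/-- There is an edge of the cube from `v` to `w`, which changes the crossing `c`. -/
abbrev IsEdge (v w : Resolution n) (c : Fin n) : Prop := v c = false ∧ w = Function.update v c true

/-- The saddles are disoriented cobordisms of degree `0`. -/
def SaddlesOK : Prop :=
  ∀ (v : Resolution n) (c : Fin n), v c = false →
    IsCobordism (D.smoothing v) (D.smoothing (Function.update v c true)) (D.saddlePolygons v c) ∧
    twiceEuler (D.saddlePolygons v c) - ((p : ℤ) + q) + 2 = 0

instance : Decidable D.SaddlesOK := by
  unfold SaddlesOK
  infer_instance

theorem weight_update {v w : Resolution n} {c : Fin n} (h : IsEdge v w c) :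
    w.weight = v.weight + 1 := by
  obtain ⟨h, rfl⟩ := h
  unfold Resolution.weight
  have : (Finset.univ.filter fun i => Function.update v c true i = true) =
      insert c (Finset.univ.filter fun i => v i = true) := by
    ext i
    by_cases hi : i = c
    · subst hi; simp
    · simp [hi]
  rw [this, Finset.card_insert_of_notMem (by simp [h])]

variable {D}

/-- The saddle along an edge of the cube. -/
def saddle (hD : D.SaddlesOK) {v w : Resolution n} {c : Fin n} (h : IsEdge v w c) :
    Cob (D.vertex v) (D.vertex w) where
  polygons := D.saddlePolygons v c
  isCobordism := by
    obtain ⟨h, rfl⟩ := h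
    exact (hD v c h).1
  degree := by
    have h1 := weight_update h
    have h2 := (hD v c h.1).2
    simp only [vertex, h1]
    push_cast
    linarith

variable (k ω)

/-- The component of the differential from the vertex `v` to the vertex `w` of the cube.  The saddle
at the crossing `c` has the sign `-1` to the number of later crossings resolved in the disoriented
way, which is the sign in the tensor product of the complexes
`q (oriented smoothing) ⟶ q ^ 2 (disoriented smoothing)` of the single crossings. -/
noncomputable def edgeMap (hD : D.SaddlesOK) (v w : Resolution n) :
    toDisAb k ω (D.vertex v) ⟶ toDisAb k ω (D.vertex w) :=
  ∑ c : Fin n, if h : IsEdge v w c then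
    ((-1 : k) ^ (Finset.univ.filter fun j => c < j ∧ v j).card) • ofCob k ω (saddle hD h) else 0

variable (D) in
/-- The formal direct sum of the vertices of the cube in homological height `i`. -/
noncomputable def chainObj (i : ℤ) : Mat_ (DisAb k ω p q) where
  ι := {v : Resolution n // (v.weight : ℤ) = i}
  X v := toDisAb k ω (D.vertex v.1)

/-- The matrix of the differential. -/
noncomputable def chainD (hD : D.SaddlesOK) (i j : ℤ) :
    D.chainObj k ω i ⟶ D.chainObj k ω j :=
  fun v w => edgeMap k ω hD v.1 w.1

theorem chainD_shape (hD : D.SaddlesOK) (i j : ℤ) (hij : i + 1 ≠ j) :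
    chainD k ω hD i j = 0 := by
  ext ⟨v, hv⟩ ⟨w, hw⟩
  change edgeMap k ω hD v w = 0
  unfold edgeMap
  refine Finset.sum_eq_zero fun c _ => dif_neg fun h => hij ?_
  have := weight_update h
  omega

/-- The square of the differential vanishes. -/
def SquareZero (hD : D.SaddlesOK) : Prop :=
  ∀ i : ℤ, chainD k ω hD i (i + 1) ≫ chainD k ω hD (i + 1) (i + 1 + 1) = 0

/-- The complex of the diagram, in formal direct sums of objects of `DisAb`. -/
noncomputable def complex (hD : D.SaddlesOK) (h : SquareZero k ω hD) :
    CochainComplex (Mat_ (DisAb k ω p q)) ℤ where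
  X := D.chainObj k ω
  d := chainD k ω hD
  shape i j hij := chainD_shape k ω hD i j hij
  d_comp_d' i j l hij hjl := by
    obtain rfl : i + 1 = j := hij
    obtain rfl : i + 1 + 1 = l := hjl
    exact h i

end Diagram

/-! ## The two sides of the Reidemeister move

Three strands run upwards in three columns.  The strand starting on the left is the highest one and
finishes on the right, the middle strand starts and finishes in the middle, and the lowest strand
starts on the right and finishes on the left.  Thus, counterclockwise around the boundary, one sees
the outgoing ends of the high, middle and low strands, in this order.  All crossings are positive.
The arcs `0, 1, 2` start at the bottom and the arcs `3, 4, 5` finish at the top. -/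

/-- The initial tangle, with the triangle to the left of the lowest strand.  From bottom to top,
the crossings are: high with middle strand (left and middle column; number `2` in the ordering),
high with low strand (middle and right column; number `0`), middle with low strand (left and middle
column; number `1`). -/
def initialTangle : Diagram 3 3 3 where
  arcs := 9
  crossing := ![⟨7, 2, 8, 5⟩, ⟨6, 8, 3, 4⟩, ⟨0, 1, 6, 7⟩]
  ins := [0, 1, 2]
  outs := [3, 4, 5]
  ins_length := rfl
  outs_length := rfl
  final_perm := by decide
  initial_perm := by decide

/-- The final tangle, with the triangle to the right of the lowest strand.  From bottom to top, the
crossings are: middle with low strand (middle and right column; number `0` in the ordering), high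
with low strand (left and middle column; number `1`), high with middle strand (middle and right
column; number `2`). -/
def finalTangle : Diagram 3 3 3 where
  arcs := 9
  crossing := ![⟨1, 2, 6, 7⟩, ⟨0, 6, 3, 8⟩, ⟨8, 7, 4, 5⟩]
  ins := [0, 1, 2]
  outs := [3, 4, 5]
  ins_length := rfl
  outs_length := rfl
  final_perm := by decide
  initial_perm := by decide

theorem initialTangle_ok : initialTangle.SaddlesOK := by decide +kernel

theorem finalTangle_ok : finalTangle.SaddlesOK := by decide +kernel

/-! ## The chain map -/

/-- The surfaces which occur as components of the chain map, from the smoothing `v` of the initial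
tangle to the smoothing `w` of the final tangle.  They are unions of discs, carrying the unique
configuration of seams without closed seams; polygons are the regions of the discs. -/
def r3Polygons (v w : Resolution 3) : Option Polygons :=
  match v 0, v 1, v 2, w 0, w 1, w 2 with
  -- the identity `000 ⟶ 000`
  | false, false, false, false, false, false => some
      [[src 3, src 6, src 0, tgt 0, tgt 3], [src 4, src 8, src 7, src 1, tgt 1, tgt 6, tgt 8, tgt 4],
        [src 5, src 2, tgt 2, tgt 7, tgt 5]]
  -- the identity `100 ⟶ 100`
  | true, false, false, true, false, false => some
      [[src 3, src 6, src 0, tgt 0, tgt 3], [src 7, src 1, tgt 1, tail 0], [src 2, tgt 2, head 0],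
        [src 4, src 8, tail 1, tgt 6, tgt 8, tgt 4], [src 5, head 1, tgt 7, tgt 5]]
  -- the identity `010 ⟶ 010`
  | false, true, false, false, true, false => some
      [[src 6, src 0, tgt 0, tail 0], [src 8, src 7, src 1, tgt 1, tgt 6, head 0],
        [src 3, tail 1, tgt 3], [src 4, head 1, tgt 8, tgt 4], [src 5, src 2, tgt 2, tgt 7, tgt 5]]
  -- the identity `110 ⟶ 110`
  | true, true, false, true, true, false => some
      [[src 7, src 1, tgt 1, tail 0], [src 2, tgt 2, head 0], [src 6, src 0, tgt 0, tail 1],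
        [src 8, tail 2, tgt 6, head 1], [src 5, head 2, tgt 7, tgt 5], [src 3, tail 3, tgt 3],
        [src 4, head 3, tgt 8, tgt 4]]
  -- the identity `100 ⟶ 001`
  | true, false, false, false, false, true => some
      [[src 3, src 6, src 0, tgt 0, tgt 3], [src 7, src 1, tgt 1, tgt 6, tgt 8, tail 0],
        [src 2, tgt 2, tgt 7, head 0], [src 4, src 8, tail 1, tgt 4], [src 5, head 1, tgt 5]]
  -- `110 ⟶ 101`: a curtain, the birth of a circle, and a saddle
  | true, true, false, true, false, true => some
      [[src 7, src 1, tgt 1, tail 0], [src 2, tgt 2, head 0], [tgt 6, tgt 8, tail 1],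
        [tgt 7, head 1], [src 6, src 0, tgt 0, tgt 3, src 3, tail 2],
        [src 4, head 2, src 8, tail 3, tgt 4], [src 5, head 3, tgt 5]]
  -- `101 ⟶ 101`: a curtain, the birth of a circle, and a saddle
  | true, false, true, true, false, true => some
      [[src 4, src 8, tail 0, tgt 4], [src 5, head 0, tgt 5], [tgt 6, tgt 8, tail 1],
        [tgt 7, head 1], [src 2, tgt 2, head 2], [src 1, tgt 1, tail 2, src 7, head 3],
        [src 3, src 6, tail 3, src 0, tgt 0, tgt 3]]
  -- `011 ⟶ 101`: the death of a circle, the birth of a circle, and a monkey saddle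
  | false, true, true, true, false, true => some
      [[src 6, tail 0], [src 8, src 7, head 0], [tgt 6, tgt 8, tail 1], [tgt 7, head 1],
        [src 3, tail 2, src 0, tgt 0, tgt 3], [src 4, head 2, src 1, tgt 1, tail 3, tgt 4],
        [src 5, src 2, tgt 2, head 3, tgt 5]]
  -- the identity `101 ⟶ 011`
  | true, false, true, false, true, true => some
      [[src 0, tgt 0, tail 0], [src 1, tgt 1, tgt 6, head 0], [src 2, tgt 2, tgt 7, head 1],
        [src 7, head 2, tgt 8, tail 1], [src 3, src 6, tail 2, tgt 3], [src 4, src 8, tail 3, tgt 4],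
        [src 5, head 3, tgt 5]]
  -- `011 ⟶ 011`: a curtain, the death of a circle, and a saddle
  | false, true, true, false, true, true => some
      [[src 0, tgt 0, tail 0], [src 1, tgt 1, tgt 6, head 0], [src 6, tail 1],
        [src 8, src 7, head 1], [src 3, tail 2, tgt 3], [src 4, head 2, tgt 8, tail 3, tgt 4],
        [src 5, src 2, tgt 2, tgt 7, head 3, tgt 5]]
  | _, _, _, _, _, _ => none

/-- The coefficients of the components of the chain map. -/
def r3Coeff (ω : k) (v w : Resolution 3) : k :=
  match v 0, v 1, v 2, w 0, w 1, w 2 with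
  | true, true, false, true, false, true => ω ^ 2
  | true, false, true, true, false, true => -ω ^ 2
  | false, true, true, true, false, true => ω ^ 2
  | true, false, true, false, true, true => -1
  | _, _, _, _, _, _ => 1

theorem r3Polygons_ok : ∀ v w : Resolution 3, ∀ W ∈ r3Polygons v w,
    IsCobordism (initialTangle.smoothing v) (finalTangle.smoothing w) W ∧
    twiceEuler W - (((3 : ℕ) : ℤ) + (3 : ℕ)) +
      2 * ((finalTangle.vertex w).shift - (initialTangle.vertex v).shift) = 0 := by
  decide +kernel

/-- The component of the chain map from the smoothing `v` of the initial tangle to the smoothing `w`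
of the final tangle. -/
noncomputable def r3Map (k : Type*) [CommRing k] [Invertible (2 : k)] (ω : kˣ)
    (v w : Resolution 3) :
    toDisAb k ω (initialTangle.vertex v) ⟶ toDisAb k ω (finalTangle.vertex w) :=
  match h : r3Polygons v w with
  | some W => r3Coeff (ω : k) v w •
      ofCob k ω (X := initialTangle.vertex v) (Y := finalTangle.vertex w)
        ⟨W, (r3Polygons_ok v w W h).1, (r3Polygons_ok v w W h).2⟩
  | none => 0

end Disoriented

/-! Among the smoothings, only L011 and R101 contain a closed circle. Neck cutting replaces the
circle by two shifted copies of the remaining arcs; one copy cancels against L001 (respectively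
R001), across the saddle that splits off the circle, and the other against L111 (respectively R111),
across the saddle that merges it. The survivors L000, L100, L010, L110, L101 and R000, R100, R010,
R110, R011 correspond to each other, L101 being matched with R011 by minus the identity. The
homotopies are accordingly caps and births of the circle: `initialHomotopy` lives on 011 → 001 and
111 → 011, `finalHomotopy` on 101 → 001 and 111 → 101.

Once the inverse `r3InvMat` and the homotopies are written down, six matrix identities remain: both
differentials square to zero, both maps commute with the differentials, and both composites plus dC
+ Cd equal the identity, where C is the homotopy matrix. Every entry is an explicit finite sum of
glued polygonal surfaces with coefficients of the form integer times a power of ω, and it is proved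
to vanish by computation. Each surface is brought to a normal form by elementary moves, closed seams
are removed, seams are recoupled, necks are cut and spherical components are deleted, until the
integer coefficients cancel. The only property of ω used is ω⁴ = 1, which holds in both cases of the
hypothesis.

Only soundness of the procedure is proved. Each step is certified by a check made during the
computation, and a failed check leaves the term as it was. Hence nothing is needed about termination
or uniqueness of normal forms. The carrying results are `valid_of_validTest` (the numerical test
implies being a cobordism of degree 0), `normalize_equivalent` (normal forms present the same
surface), `reduce_spec`, `cutNeck_spec` and `eval_eq_zero_of_vanishes` (the local relations), and
`CombMat.block_mul` (matrix products are compositions of chain objects). -/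

namespace Disoriented
open Side
variable {p q : ℕ}

/-! ## A fast test for disoriented cobordisms

Sides and their end points are numbered, and maps between them are tabulated in natural numbers,
for which the kernel has fast arithmetic. -/

/-- Evaluate a natural number before passing it on. -/
noncomputable def force {α : Type} (n : ℕ) (f : ℕ → α) : α :=
  Nat.rec (f 0) (fun m _ => f (Nat.succ m)) n

-- Logically `force` is mere application. Its recursor makes the kernel reduce `n` to a literal
-- before it is substituted, so that a value used several times is computed once.
@[simp] theorem force_eq {α : Type} (n : ℕ) (f : ℕ → α) : force n f = f n := by
  cases n <;> rfl

/-- The number of a side. -/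
def Side.code : Side → ℕ
  | src e => Nat.mul 6 e
  | tgt e => Nat.add (Nat.mul 6 e) 1
  | fwd x => Nat.add (Nat.mul 6 x) 2
  | bwd x => Nat.add (Nat.mul 6 x) 3
  | head y => Nat.add (Nat.mul 6 y) 4
  | tail y => Nat.add (Nat.mul 6 y) 5

theorem Side.code_injective : Function.Injective Side.code := by
  intro s t h
  cases s <;> cases t <;> simp only [code, Nat.mul_eq, Nat.add_eq] at h <;>
    (congr 1; omega)

/-- The number of an end point of a side. -/
def germCode (g : Germ) : ℕ :=
  bif g.2 then Nat.add (Nat.mul 2 g.1.code) 1 else Nat.mul 2 g.1.code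

/-- The parity is the end point and the residue of the side code modulo 6 is its kind. Hence the
residue modulo 12 tells both, which is what the later tests read off. -/
theorem germCode_injective : Function.Injective germCode := by
  rintro ⟨s, b⟩ ⟨t, c⟩ h
  cases b <;> cases c <;> simp only [germCode, cond_true, cond_false, Nat.mul_eq, Nat.add_eq] at h
  · rw [code_injective (by omega : s.code = t.code)]
  · omega
  · omega
  · rw [code_injective (by omega : s.code = t.code)]

/-! ### Finite sets of numbers as bit masks. -/

namespace Fast

/-- Membership in a set of numbers, which is encoded as a sum of powers of `2`. -/
def bit (m a : ℕ) : Bool := Nat.beq (Nat.land (Nat.shiftRight m a) 1) 1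

/-- Insert an element into a set of numbers. -/
def insert (m a : ℕ) : ℕ := Nat.lor m (Nat.shiftLeft 1 a)

theorem bit_eq (m a : ℕ) : bit m a = m.testBit a := by
  have h : ∀ n k : ℕ, Nat.beq n k = decide (n = k) := fun n k => by
    rw [Bool.eq_iff_iff]; simp
  rw [bit, h, Nat.testBit_eq_decide_div_mod_eq]
  change decide ((m >>> a) &&& 1 = 1) = _
  rw [Nat.and_one_is_mod, Nat.shiftRight_eq_div_pow]

theorem bit_insert (m a b : ℕ) : bit (insert m a) b = true ↔ b = a ∨ bit m b = true := by
  rw [bit_eq, bit_eq]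
  change (m ||| 1 <<< a).testBit b = true ↔ _
  rw [Nat.testBit_or, Nat.one_shiftLeft, Nat.testBit_two_pow, Bool.or_eq_true, decide_eq_true_iff,
    or_comm, eq_comm]

theorem bit_zero (a : ℕ) : bit 0 a = false := by rw [bit_eq, Nat.zero_testBit]

/-- The set of the numbers in a list. -/
noncomputable def mask (l : List ℕ) : ℕ :=
  List.rec (motive := fun _ => ℕ → ℕ) (fun m => m) (fun a _ ih m => force (insert m a) ih) l 0

theorem bit_mask (l : List ℕ) (a : ℕ) : bit (mask l) a = true ↔ a ∈ l := by
  have h : ∀ (l : List ℕ) (m : ℕ), bit (List.rec (motive := fun _ => ℕ → ℕ) (fun m => m)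
      (fun a _ ih m => force (insert m a) ih) l m) a = true ↔ a ∈ l ∨ bit m a = true := by
    intro l
    induction l with
    | nil => simp
    | cons b l ih =>
      intro m
      dsimp only
      rw [force_eq, ih, bit_insert, List.mem_cons]
      tauto
  rw [mask, h, bit_zero]
  simp

/-- Are the elements of the list distinct? -/
noncomputable def nodup (l : List ℕ) : Bool :=
  List.rec (motive := fun _ => ℕ → Bool) (fun _ => true)
    (fun a _ ih m => bif bit m a then false else force (insert m a) ih) l 0

theorem nodup_of_nodup {l : List ℕ} (h : nodup l = true) : l.Nodup := by
  -- With a general accumulator the statement must also say that the list avoids the elements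
  -- already seen.
  have key : ∀ (l : List ℕ) (m : ℕ), List.rec (motive := fun _ => ℕ → Bool) (fun _ => true)
      (fun a _ ih m => bif bit m a then false else force (insert m a) ih) l m = true →
      l.Nodup ∧ ∀ a ∈ l, bit m a = false := by
    intro l
    induction l with
    | nil => simp
    | cons b l ih =>
      intro m hm
      dsimp only at hm
      rw [force_eq] at hm
      rcases hb : bit m b with _ | _
      · rw [hb, cond_false] at hm
        obtain ⟨h1, h2⟩ := ih _ hm
        have h3 : ∀ a ∈ l, a ≠ b ∧ bit m a = false := by
          intro a ha
          have := h2 a ha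
          rw [← Bool.not_eq_true, bit_insert, not_or, Bool.not_eq_true] at this
          exact this
        refine ⟨List.nodup_cons.2 ⟨fun hbl => (h3 b hbl).1 rfl, h1⟩, ?_⟩
        intro a ha
        rcases List.mem_cons.1 ha with rfl | ha
        · exact hb
        · exact (h3 a ha).2
      · rw [hb] at hm
        simp at hm
  exact (key l 0 h).1

/-! ### Corners and gluing of sides in terms of numbers. -/

/-- The `i`-th entry of a table. -/
def entry (T i : ℕ) : ℕ := Nat.mod (Nat.shiftRight T (Nat.mul 11 i)) 2048

/-- The table of the function `corner`. -/
noncomputable def table (W : Polygons) : ℕ :=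
  List.rec (motive := fun _ => ℕ → ℕ) (fun T => T)
    (fun P _ ih T => force (germCode (P.1, true)) fun a => force (germCode (P.2, false)) fun b =>
      force (Nat.add T (Nat.add (Nat.shiftLeft b (Nat.mul 11 a)) (Nat.shiftLeft a (Nat.mul 11 b))))
        ih) (successors W) 0

/-- Is the table right? -/
noncomputable def tableOK (W : Polygons) (T : ℕ) : Bool :=
  List.rec true
    (fun P _ ih => force (germCode (P.1, true)) fun a => force (germCode (P.2, false)) fun b =>
      bif Nat.beq (entry T a) b then (bif Nat.beq (entry T b) a then ih else false) else false)
    (successors W)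

/-- Every entry is read back by `tableOK`. So it need not be argued that the codes fit into 11 bits
or that the summands in `table` occupy different slots. -/
theorem entry_of_tableOK {W : Polygons} {T : ℕ} (h : tableOK W T = true) :
    ∀ P ∈ successors W, entry T (germCode (P.1, true)) = germCode (P.2, false) ∧
      entry T (germCode (P.2, false)) = germCode (P.1, true) := by
  rw [tableOK] at h
  generalize successors W = l at h
  induction l with
  | nil => simp
  | cons P l ih =>
    dsimp only at h
    rw [force_eq, force_eq] at h
    rcases h1 : Nat.beq (entry T (germCode (P.1, true))) (germCode (P.2, false)) with _ | _
    · rw [h1] at h; simp at h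
    rcases h2 : Nat.beq (entry T (germCode (P.2, false))) (germCode (P.1, true)) with _ | _
    · rw [h1, h2] at h; simp at h
    rw [h1, h2] at h
    intro Q hQ
    rcases List.mem_cons.1 hQ with rfl | hQ
    · exact ⟨Nat.eq_of_beq_eq_true h1, Nat.eq_of_beq_eq_true h2⟩
    · exact ih h Q hQ

/-- The shift by `3` of the change of numbers effected by `cross`, depending on the residue. -/
def crossDigit (r : ℕ) : ℕ := Nat.mod (Nat.shiftRight 0x115502460000 (Nat.mul 4 r)) 16

/-- Residues 4 to 11 are the germs of interior sides. Each digit is 3 plus the change of code: fwd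
and bwd are exchanged with reversal of the end (changes 3, 1, -1, -3), head and tail without
(changes 2 and -2). -/
theorem crossDigit_eq : crossDigit 4 = 6 ∧ crossDigit 5 = 4 ∧ crossDigit 6 = 2 ∧ crossDigit 7 = 0 ∧
    crossDigit 8 = 5 ∧ crossDigit 9 = 5 ∧ crossDigit 10 = 1 ∧ crossDigit 11 = 1 := by
  decide +kernel

/-- The function `cross` on numbers of end points of interior sides. -/
def crossCode (h : ℕ) : ℕ := Nat.sub (Nat.add h (crossDigit (Nat.mod h 12))) 3

end Fast

open Fast

theorem germCode_mod (g : Germ) : germCode g % 12 =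
    match g with
    | (src _, b) => 0 + b.toNat
    | (tgt _, b) => 2 + b.toNat
    | (fwd _, b) => 4 + b.toNat
    | (bwd _, b) => 6 + b.toNat
    | (head _, b) => 8 + b.toNat
    | (tail _, b) => 10 + b.toNat := by
  obtain ⟨s, b⟩ := g
  cases s <;> cases b <;>
    simp only [germCode, code, cond_true, cond_false, Nat.mul_eq, Nat.add_eq, Bool.toNat_true,
      Bool.toNat_false] <;> omega

theorem crossCode_germCode {g g' : Germ} (h : cross g = some g') :
    crossCode (germCode g) = germCode g' := by
  have hm := germCode_mod g
  have hc : crossCode (germCode g) = germCode g + crossDigit (germCode g % 12) - 3 := by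
    simp only [crossCode, Nat.sub_eq, Nat.add_eq]
    rfl
  obtain ⟨h4, h5, h6, h7, h8, h9, h10, h11⟩ := crossDigit_eq
  obtain ⟨s, b⟩ := g
  rw [hc, hm]
  cases s <;> cases b <;> simp only [cross, Option.some.injEq, reduceCtorEq] at h <;> subst h <;>
    simp only [Bool.toNat_true, Bool.toNat_false, Nat.reduceAdd, h4, h5, h6, h7, h8, h9, h10, h11,
      germCode, code, cond_true, cond_false, Nat.mul_eq, Nat.add_eq, Bool.not_true,
      Bool.not_false] <;> omega

/-- Residues 0 to 3 are exactly the germs of boundary sides. -/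
theorem cross_eq_none_iff (g : Germ) :
    cross g = none ↔ Nat.ble (Nat.mod (germCode g) 12) 3 = true := by
  have hm := germCode_mod g
  change _ ↔ Nat.ble (germCode g % 12) 3 = true
  rw [hm]
  obtain ⟨s, b⟩ := g
  cases s <;> cases b <;> simp [cross]

theorem mem_flatten_of_mem_successors {W : Polygons} {s t : Side} (h : (s, t) ∈ successors W) :
    s ∈ W.flatten ∧ t ∈ W.flatten := by
  simp only [successors, List.mem_flatMap] at h
  obtain ⟨w, hw, h⟩ := h
  have h1 := List.of_mem_zip h
  refine ⟨List.mem_flatten.2 ⟨w, hw, h1.1⟩, List.mem_flatten.2 ⟨w, hw, ?_⟩⟩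
  rcases List.mem_append.1 h1.2 with h2 | h2
  · exact List.mem_of_mem_drop h2
  · exact List.mem_of_mem_take h2

theorem exists_successor {W : Polygons} {s : Side} (h : s ∈ W.flatten) :
    (∃ t, (s, t) ∈ successors W) ∧ ∃ t, (t, s) ∈ successors W := by
  obtain ⟨w, hw, h⟩ := List.mem_flatten.1 h
  have hl : w.length = (w.drop 1 ++ w.take 1).length := by
    simp only [List.length_append, List.length_drop, List.length_take]; omega
  have h1 : s ∈ (w.zip (w.drop 1 ++ w.take 1)).map Prod.fst := by
    rwa [List.map_fst_zip hl.le]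
  have h2 : s ∈ (w.zip (w.drop 1 ++ w.take 1)).map Prod.snd := by
    rw [List.map_snd_zip hl.ge, List.mem_append, or_comm, ← List.mem_append, List.take_append_drop]
    exact h
  simp only [List.mem_map, Prod.exists, exists_and_right, exists_eq_right] at h1 h2
  obtain ⟨t, ht⟩ := h1
  obtain ⟨t', ht'⟩ := h2
  exact ⟨⟨t, List.mem_flatMap.2 ⟨w, hw, ht⟩⟩, ⟨t', List.mem_flatMap.2 ⟨w, hw, ht'⟩⟩⟩

/-- The default value in `corner` is never reached for a side that occurs. -/
theorem lookup_getD_mem {l : List (Side × Side)} {s : Side} (h : ∃ t, (s, t) ∈ l) (d : Side) :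
    (s, (l.lookup s).getD d) ∈ l := by
  rcases hl : l.lookup s with _ | t
  · obtain ⟨t, ht⟩ := h
    rw [List.lookup_eq_none_iff] at hl
    simpa using hl _ ht
  · obtain ⟨l₁, l₂, rfl, -⟩ := List.lookup_eq_some_iff.1 hl
    simp

/-- Distinctness of the sides plays no role: `corner` returns some pair of `successors W`, and the
table was checked against all of them. The second conclusion keeps a walk inside the polygons, so
that the lemma can be applied again at its next corner. -/
theorem entry_corner {W : Polygons} {T : ℕ} (hT : tableOK W T = true) {g : Germ}
    (hg : g.1 ∈ W.flatten) :
    entry T (germCode g) = germCode (corner W g) ∧ (corner W g).1 ∈ W.flatten := by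
  obtain ⟨h1, h2⟩ := exists_successor hg
  obtain ⟨s, b⟩ := g
  cases b
  · have h3 : (s, (((successors W).map Prod.swap).lookup s).getD s) ∈
        (successors W).map Prod.swap := by
      apply lookup_getD_mem
      obtain ⟨t, ht⟩ := h2
      exact ⟨t, List.mem_map.2 ⟨_, ht, rfl⟩⟩
    obtain ⟨⟨t, s'⟩, h4, h5⟩ := List.mem_map.1 h3
    simp only [Prod.swap_prod_mk, Prod.mk.injEq] at h5
    obtain ⟨rfl, h5⟩ := h5
    rw [corner, ← h5]
    exact ⟨(entry_of_tableOK hT _ h4).2, (mem_flatten_of_mem_successors h4).1⟩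
  · have h3 := lookup_getD_mem h1 s
    rw [corner]
    exact ⟨(entry_of_tableOK hT _ h3).1, (mem_flatten_of_mem_successors h3).2⟩

/-- With each interior side, its mate occurs as well. -/
def MateClosed (W : Polygons) : Prop := ∀ s ∈ W.flatten, ∀ t, mate s = some t → t ∈ W.flatten

theorem MateClosed.cross {W : Polygons} (hW : MateClosed W) {g g' : Germ} (hg : g.1 ∈ W.flatten)
    (h : cross g = some g') : g'.1 ∈ W.flatten := by
  refine hW _ hg _ ?_
  obtain ⟨s, b⟩ := g
  cases s <;> simp_all [Disoriented.cross, mate] <;> rw [← h]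

/-! ### Walks around vertices in terms of numbers. -/

namespace Fast

/-- The function `sectorAux` on numbers of end points. -/
noncomputable def sectorAux (T n G : ℕ) : ℕ :=
  Nat.rec (motive := fun _ => ℕ → ℕ) (fun G => G)
    (fun _ ih G => force (entry T G) fun h => force (Nat.mod h 12) fun r =>
      bif Nat.ble 4 r then (bif Nat.ble r 7 then force (crossCode h) ih else h) else h) n G

/-- Step-by-step simulation: `entry_corner` matches the passage of a corner, and residues 4 to 7 are
the ordinary sides through which the walk goes on. `MateClosed` preserves membership when an edge is
crossed. -/
theorem sectorAux_eq {W : Polygons} {T : ℕ} (hT : tableOK W T = true) (hW : MateClosed W) (n : ℕ) :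
    ∀ g : Germ, g.1 ∈ W.flatten →
      sectorAux T n (germCode g) = germCode (Disoriented.sectorAux W n g) := by
  induction n with
  | zero => intro g _; rfl
  | succ n ih =>
    intro g hg
    obtain ⟨h1, h2⟩ := entry_corner hT hg
    have h3 : sectorAux T (n + 1) (germCode g) =
        bif Nat.ble 4 (germCode (corner W g) % 12) then
          (bif Nat.ble (germCode (corner W g) % 12) 7 then
            sectorAux T n (crossCode (germCode (corner W g))) else germCode (corner W g))
        else germCode (corner W g) := by
      rw [← h1]
      simp [sectorAux]
      rfl
    have h4 : ∀ g', Disoriented.cross (corner W g) = some g' →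
        sectorAux T n (crossCode (germCode (corner W g))) =
          germCode (Disoriented.sectorAux W n g') := by
      intro g' hg'
      rw [crossCode_germCode hg']
      exact ih _ (hW.cross h2 hg')
    rw [h3, germCode_mod, Disoriented.sectorAux]
    revert h4
    generalize corner W g = c
    intro h4
    obtain ⟨s, b⟩ := c
    cases s <;> cases b <;> simp [Disoriented.cross] at h4 ⊢ <;>
      first | exact h4 | rfl

/-- The function `orbitAux` on numbers of end points; the orbit is added to the set `m`, and the
value is `0` if one runs into the boundary. -/
noncomputable def orbitAux (T start n G m : ℕ) : ℕ :=
  Nat.rec (motive := fun _ => ℕ → ℕ → ℕ) (fun _ _ => 0)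
    (fun _ ih G m => force (entry T G) fun h =>
      bif Nat.ble (Nat.mod h 12) 3 then 0 else
        force (crossCode h) fun g => force (insert m g) fun m' =>
          bif Nat.beq g start then m' else ih g m') n G m

theorem orbitAux_eq {W : Polygons} {T : ℕ} (hT : tableOK W T = true) (hW : MateClosed W)
    (start : Germ) (n : ℕ) : ∀ (g : Germ) (m : ℕ), g.1 ∈ W.flatten →
      match Disoriented.orbitAux W start n g with
      | none => orbitAux T (germCode start) n (germCode g) m = 0
      | some c => orbitAux T (germCode start) n (germCode g) m ≠ 0 ∧
          ∀ a, bit (orbitAux T (germCode start) n (germCode g) m) a = true ↔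
            a ∈ c.map germCode ∨ bit m a = true := by
  induction n with
  | zero => intro g m _; rfl
  | succ n ih =>
    intro g m hg
    obtain ⟨h1, h2⟩ := entry_corner hT hg
    have h3 : orbitAux T (germCode start) (n + 1) (germCode g) m =
        bif Nat.ble (Nat.mod (germCode (corner W g)) 12) 3 then 0 else
          bif Nat.beq (crossCode (germCode (corner W g))) (germCode start) then
            insert m (crossCode (germCode (corner W g)))
          else orbitAux T (germCode start) n (crossCode (germCode (corner W g)))
            (insert m (crossCode (germCode (corner W g)))) := by
      rw [← h1]
      simp [orbitAux]
    rw [h3, Disoriented.orbitAux]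
    rcases hc : Disoriented.cross (corner W g) with _ | g'
    · have := (cross_eq_none_iff _).1 hc
      simp only [this, cond_true]
    · have hb : Nat.ble (Nat.mod (germCode (corner W g)) 12) 3 = false := by
        rw [← Bool.not_eq_true, ← cross_eq_none_iff, hc]; simp
      rw [hb, crossCode_germCode hc, cond_false]
      by_cases hs : g' = start
      · subst hs
        have h4 : Nat.beq (germCode g') (germCode g') = true := Nat.beq_refl _
        simp only [if_true, h4, cond_true]
        have h5 : ∀ a, bit (insert m (germCode g')) a = true ↔
            a ∈ [g'].map germCode ∨ bit m a = true := by
          intro a; rw [bit_insert]; simp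
        refine ⟨?_, h5⟩
        -- A set with an element inserted has a nonzero mask, so 0 is free to encode `none`.
        intro h0
        have := (h5 (germCode g')).2 (Or.inl (by simp))
        rw [h0, bit_zero] at this
        exact Bool.false_ne_true this
      · have h4 : Nat.beq (germCode g') (germCode start) = false := by
          rw [← Bool.not_eq_true]
          exact fun h => hs (germCode_injective (Nat.eq_of_beq_eq_true h))
        have h5 := ih g' (insert m (germCode g')) (hW.cross h2 hc)
        simp only [if_neg hs, h4, cond_false]
        rcases ho : Disoriented.orbitAux W start n g' with _ | c
        · rw [ho] at h5
          exact h5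
        · rw [ho] at h5
          refine ⟨h5.1, fun a => ?_⟩
          rw [h5.2, bit_insert]
          simp only [List.map_cons, List.mem_cons]
          tauto

/-- The function `closedWalks` on numbers of end points. -/
noncomputable def walks (T n : ℕ) (l : List ℕ) (m c : ℕ) : ℕ :=
  List.rec (motive := fun _ => ℕ → ℕ → ℕ) (fun _ c => c)
    (fun g _ ih m c => bif bit m g then ih m c else
      force (orbitAux T g n g m) fun m' => bif Nat.beq m' 0 then ih m c else
        force (Nat.succ c) (ih m')) l m c

/-- The invariant is that the mask holds the codes of the germs already accumulated. `orbitAux`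
returns the old mask enlarged by the new orbit, which matches `c ++ acc.1`. -/
theorem walks_eq {W : Polygons} {T : ℕ} (hT : tableOK W T = true) (hW : MateClosed W) (n : ℕ)
    (l : List Germ) : ∀ (m c : ℕ) (acc : List Germ), (∀ g ∈ l, g.1 ∈ W.flatten) →
      (∀ a, bit m a = true ↔ a ∈ acc.map germCode) →
      walks T n (l.map germCode) m c = (l.foldl (fun (acc : List Germ × ℕ) g =>
        if g ∈ acc.1 then acc else
          match Disoriented.orbitAux W g n g with
          | none => acc
          | some c => (c ++ acc.1, acc.2 + 1)) (acc, c)).2 := by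
  induction l with
  | nil => intro m c acc _ _; rfl
  | cons g l ih =>
    intro m c acc hl hm
    have hl' : ∀ g ∈ l, g.1 ∈ W.flatten := fun g hg => hl g (List.mem_cons_of_mem _ hg)
    have h1 : walks T n ((g :: l).map germCode) m c =
        bif bit m (germCode g) then walks T n (l.map germCode) m c else
          bif Nat.beq (orbitAux T (germCode g) n (germCode g) m) 0 then
            walks T n (l.map germCode) m c else
            walks T n (l.map germCode) (orbitAux T (germCode g) n (germCode g) m) (c + 1) := by
      simp [walks]
    rw [h1, List.foldl_cons]
    by_cases hg : g ∈ acc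
    · have : bit m (germCode g) = true := (hm _).2 (List.mem_map_of_mem hg)
      rw [this, cond_true, if_pos hg]
      exact ih m c acc hl' hm
    · have : bit m (germCode g) = false := by
        rw [← Bool.not_eq_true, hm, List.mem_map_of_injective germCode_injective]
        exact hg
      rw [this, cond_false, if_neg hg]
      have h2 := orbitAux_eq hT hW g n g m (hl g List.mem_cons_self)
      rcases ho : Disoriented.orbitAux W g n g with _ | d
      · rw [ho] at h2
        have h3 : orbitAux T (germCode g) n (germCode g) m = 0 := h2
        rw [h3]
        exact ih m c acc hl' hm
      · rw [ho] at h2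
        have h3 : Nat.beq (orbitAux T (germCode g) n (germCode g) m) 0 = false := by
          rw [← Bool.not_eq_true]
          exact fun h => h2.1 (Nat.eq_of_beq_eq_true h)
        rw [h3, cond_false]
        refine ih _ _ _ hl' fun a => ?_
        rw [h2.2, hm, List.map_append, List.mem_append]

end Fast

/-! ### The test for cobordisms of degree 0 and its soundness. -/

/-- The polygons `W` present a morphism from `X` to `Y`. -/
def Valid (X Y : GrTangle p q) (W : Polygons) : Prop :=
  IsCobordism X.tangle Y.tangle W ∧ twiceEuler W - ((p : ℤ) + q) + 2 * (Y.shift - X.shift) = 0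

namespace Fast

/-- Test of `sideOK`, where `M` is the set of all sides. -/
def sideTest (A B : DisTangle p q) (M : ℕ) : Side → Bool
  | src e => Nat.blt e A.edges
  | tgt e => Nat.blt e B.edges
  | fwd x => bit M (code (bwd x))
  | bwd x => bit M (code (fwd x))
  | head y => bit M (code (tail y))
  | tail y => bit M (code (head y))

/-- Test whether a sector runs from `g` to `h`. -/
noncomputable def sectorTest (M T n : ℕ) (g h : Germ) : Bool :=
  -- The numerical walk is known to be correct only if it starts at a side that occurs, hence the
  -- membership test.
  bit M (code g.1) && Nat.beq (sectorAux T n (germCode g)) (germCode h)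

/-- Test of `isSeamEnd`. -/
noncomputable def seamEndTest (a b : ℕ) : Bool :=
  -- Residues 10 and 11 mean a tail; the head with the same label and the same end has code smaller
  -- by 2.
  force a fun a => Nat.ble 10 (Nat.mod a 12) && Nat.beq a (Nat.add b 2)

/-- Test of `markAt`. -/
noncomputable def markTest (M T n : ℕ) (g h : Germ) : Bool :=
  bit M (code g.1) && (bit M (code h.1) &&
    seamEndTest (sectorAux T n (germCode g)) (sectorAux T n (germCode h)))

/-- Test of `seamOK`. -/
noncomputable def seamTest (T n : ℕ) : Side → Bool
  | head y => [false, true].all fun b =>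
      force (sectorAux T n (germCode (tail y, b))) fun t =>
        force (sectorAux T n (germCode (head y, b))) fun h =>
          (Nat.ble (Nat.mod t 12) 3 && Nat.ble (Nat.mod h 12) 3) || seamEndTest t h
  | _ => true

/-- Test of `IsCobordism`, where `M` is the set of all sides, `n` is their number and `T` is the
table of corners. -/
noncomputable def cobordismTest (A B : DisTangle p q) (W : Polygons) (M T n : ℕ) : Bool :=
  W.all (fun w => !w.isEmpty) && (nodup (W.flatten.map code) &&
  (W.flatten.all (sideTest A B M) &&
  ((List.range A.edges).all (fun e => bit M (code (src e))) &&
  ((List.range B.edges).all (fun e => bit M (code (tgt e))) &&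
  (tableOK W T &&
  (A.plain.all (fun t => sectorTest M T n (src t.1, false) (src t.2, true)) &&
  (B.plain.all (fun t => sectorTest M T n (tgt t.1, true) (tgt t.2, false)) &&
  ((A.ins.zip B.ins).all (fun t => sectorTest M T n (src t.1, true) (tgt t.2, false)) &&
  ((A.outs.zip B.outs).all (fun t => sectorTest M T n (src t.1, false) (tgt t.2, true)) &&
  (A.heads.all (fun t => markTest M T n (src t.1, false) (src t.2, false)) &&
  (A.tails.all (fun t => markTest M T n (src t.1, true) (src t.2, true)) &&
  (B.heads.all (fun t => markTest M T n (tgt t.1, true) (tgt t.2, true)) &&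
  (B.tails.all (fun t => markTest M T n (tgt t.1, false) (tgt t.2, false)) &&
  W.flatten.all (seamTest T n))))))))))))))

/-- Test of `Valid`. -/
noncomputable def validTest (X Y : GrTangle p q) (W : Polygons) : Bool :=
  force (mask (W.flatten.map code)) fun M => force (table W) fun T =>
    force W.flatten.length fun n =>
      cobordismTest X.tangle Y.tangle W M T n &&
        -- The bound on the length of orbits is the number of germs, two for each of the `n` sides.
        force (walks T (Nat.mul n 2) ((germs W).map germCode) 0 0) fun c =>
          decide (2 * (W.length : ℤ) - 2 * ((W.flatten.filter isLeading).length : ℤ) + (c : ℤ) -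
            ((p : ℤ) + q) + 2 * (Y.shift - X.shift) = 0)

theorem isSeamEnd_of_seamEndTest {g h : Germ}
    (H : seamEndTest (germCode g) (germCode h) = true) : isSeamEnd g h = true := by
  simp only [seamEndTest, force_eq, Bool.and_eq_true] at H
  obtain ⟨h1, h2⟩ := H
  have h1 := Nat.le_of_ble_eq_true h1
  have h2 := Nat.eq_of_beq_eq_true h2
  have h3 : germCode g % 12 = (germCode h + 2) % 12 := by rw [h2, Nat.add_eq]
  change 10 ≤ germCode g % 12 at h1
  have hg := germCode_mod g
  have hh := germCode_mod h
  obtain ⟨s, b⟩ := g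
  obtain ⟨t, c⟩ := h
  cases s <;> cases t <;> cases b <;> cases c <;>
    simp only [Bool.toNat_true, Bool.toNat_false] at hg hh <;> first | omega | skip
  all_goals
    simp [germCode, code] at h2
    simp [isSeamEnd]
    omega

end Fast

theorem valid_of_validTest {X Y : GrTangle p q} {W : Polygons} (h : validTest X Y W = true) :
    Valid X Y W := by
  simp only [validTest, force_eq, cobordismTest, Bool.and_eq_true, List.all_eq_true] at h
  generalize hT : table W = T at h
  generalize hM : mask (W.flatten.map code) = M at h
  obtain ⟨⟨h1, h2, h3, h4, h5, h6, h7, h8, h9, h10, h11, h12, h13, h14, h15⟩, h16⟩ := h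
  have mem : ∀ s, bit M (code s) = true ↔ s ∈ W.flatten := fun s => by
    rw [← hM, bit_mask, List.mem_map_of_injective code_injective]
  have hW : MateClosed W := by
    intro s hs t hst
    have := h3 s hs
    cases s <;> simp only [mate, Option.some.injEq, reduceCtorEq] at hst <;> subst hst <;>
      exact (mem _).1 this
  have hsec : ∀ g : Germ, g.1 ∈ W.flatten →
      Fast.sectorAux T W.flatten.length (germCode g) = germCode (sector W g) :=
    fun g hg => Fast.sectorAux_eq h6 hW _ g hg
  have hs : ∀ g h : Germ, sectorTest M T W.flatten.length g h = true → sector W g = h := by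
    intro g h hgh
    simp only [sectorTest, Bool.and_eq_true] at hgh
    have := Nat.eq_of_beq_eq_true hgh.2
    rw [hsec g ((mem _).1 hgh.1)] at this
    exact germCode_injective this
  have hm : ∀ g h : Germ, markTest M T W.flatten.length g h = true → markAt W g h = true := by
    intro g h hgh
    simp only [markTest, Bool.and_eq_true] at hgh
    rw [hsec g ((mem _).1 hgh.1), hsec h ((mem _).1 hgh.2.1)] at hgh
    exact isSeamEnd_of_seamEndTest hgh.2.2
  have hb : ∀ g : Germ, Nat.ble (Nat.mod (germCode g) 12) 3 = true → onBoundary g.1 = true := by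
    intro g hg
    rw [← cross_eq_none_iff] at hg
    obtain ⟨s, b⟩ := g
    cases s <;> simp_all [cross, onBoundary, mate]
  refine ⟨⟨fun w hw hw' => ?_, nodup_of_nodup h2 |>.of_map _, fun s hs => ?_,
    fun e he => (mem _).1 (h4 e he),
    fun e he => (mem _).1 (h5 e he), fun t ht => hs _ _ (h7 t ht), fun t ht => hs _ _ (h8 t ht),
    fun t ht => hs _ _ (h9 t ht), fun t ht => hs _ _ (h10 t ht), fun t ht => hm _ _ (h11 t ht),
    fun t ht => hm _ _ (h12 t ht), fun t ht => hm _ _ (h13 t ht), fun t ht => hm _ _ (h14 t ht),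
    fun s hs' y hy => ?_⟩, ?_⟩
  · have := h1 w hw
    rw [hw'] at this
    exact Bool.false_ne_true this
  · have := h3 s hs
    cases s <;> simp only [sideOK, decide_eq_true_iff]
    · exact Nat.le_of_ble_eq_true this
    · exact Nat.le_of_ble_eq_true this
    all_goals exact (mem _).1 this
  · have h := h15 s hs'
    cases s <;> simp only [Option.mem_def, Option.some.injEq, reduceCtorEq] at hy
    subst hy
    rename_i y
    have ht : tail y ∈ W.flatten := hW _ hs' _ rfl
    simp only [seamTest, force_eq, List.all_eq_true, Bool.or_eq_true, Bool.and_eq_true] at h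
    simp only [seamOK, List.all_eq_true, Bool.or_eq_true, Bool.and_eq_true]
    intro b hb'
    have := h b hb'
    rw [hsec (tail y, b) ht, hsec (head y, b) hs'] at this
    rcases this with h | h
    · exact Or.inl ⟨hb _ h.1, hb _ h.2⟩
    · exact Or.inr (isSeamEnd_of_seamEndTest h)
  · have hl : (germs W).length = Nat.mul W.flatten.length 2 := by
      rw [germs]
      generalize W.flatten = l
      induction l with
      | nil => rfl
      | cons s l ih =>
        simp only [List.flatMap_cons, List.length_append, ih, List.length_cons, List.length_nil,
          Nat.mul_eq]
        omega
    have hw : walks T (Nat.mul W.flatten.length 2) ((germs W).map germCode) 0 0 =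
        closedWalks W := by
      rw [closedWalks, hl]
      refine Fast.walks_eq h6 hW _ _ 0 0 [] (fun g hg => ?_) (fun a => by simp [bit_zero])
      simp only [germs, List.mem_flatMap] at hg
      obtain ⟨s, hs, hg⟩ := hg
      simp only [List.mem_cons, List.not_mem_nil, or_false] at hg
      rcases hg with rfl | rfl <;> exact hs
    rw [hw] at h16
    exact of_decide_eq_true h16


/-! ## A normal form for polygonal presentations -/

/-- A fast version of `List.all`. -/
noncomputable def Fast.all {α : Type} (f : α → Bool) (l : List α) : Bool :=
  List.rec true (fun a _ ih => bif f a then ih else false) l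

/-- The position of a side in a list. -/
noncomputable def Fast.position (c : ℕ) (l : List Side) : ℕ :=
  List.rec 0 (fun s _ ih => bif Nat.beq s.code c then 0 else Nat.succ ih) l

/-- The polygon containing the side `s`, listed from `s` on (and with `s` dropped), together with
the other polygons. -/
noncomputable def focus (s : Side) : Polygons → Option (List Side × Polygons)
  | [] => none
  | w :: W =>
    -- If `s` does not occur in `w`, the position is the length of `w`; the rotation is then
    -- trivial, and the comparison with the first side fails.
    match w.rotate (Fast.position s.code w) with
    | [] => (focus s W).map fun r => (r.1, w :: r.2)
    | s' :: t => bif Nat.beq s'.code s.code then some (t, W) else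
      (focus s W).map fun r => (r.1, w :: r.2)

/-- The label of an ordinary edge. -/
def edgeLabel : Side → Option ℕ
  | fwd x => some x
  | bwd x => some x
  | _ => none

/-- Is this not one of the sides `fwd x`, `bwd x`? -/
def avoids (x : ℕ) : Side → Bool
  | fwd y => !Nat.beq y x
  | bwd y => !Nat.beq y x
  | _ => true

/-- The ordinary interior edge `x` does not occur. -/
noncomputable def edgeFree (x : ℕ) (W : Polygons) : Bool := Fast.all (Fast.all (avoids x)) W

/-- A number which exceeds the labels in a presentation with consecutive labels. -/
def fresh (W : Polygons) : ℕ := W.flatten.length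

/-- Paste two polygons along the edge `x`, or fold two adjacent sides. -/
noncomputable def pasteAt (x : ℕ) (W : Polygons) : Polygons :=
  match focus (fwd x) W with
  | none => W
  | some (t, R) =>
    match focus (bwd x) R with
    | some (t', R') =>
      if t ++ t' ≠ [] then
        bif edgeFree x ((t ++ t') :: R') then (t ++ t') :: R' else W
      else
        -- Two discs glued along their whole boundaries: the sphere is kept as the digon that the
        -- sphere relation expects.
        bif edgeFree x R' then [fwd x, bwd x] :: R' else W
    | none =>
      if t.head? = some (bwd x) ∧ t.tail ≠ [] ∧ edgeFree x (t.tail :: R) = true then t.tail :: R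
      else if t.getLast? = some (bwd x) ∧ t.dropLast ≠ [] ∧
        edgeFree x (t.dropLast :: R) = true then t.dropLast :: R
      else W

/-- Unite the seam edge `z` with the preceding one. -/
noncomputable def mergeSeamAt (z : ℕ) (W : Polygons) : Polygons :=
  match focus (head z) W with
  | none => W
  | some (t, R) =>
    match focus (tail z) R, t.getLast? with
    | some (t', R'), some (head y) =>
      -- The merged presentation is accepted only if subdividing `y` recovers the original one, so
      -- that the equivalence is the move itself, read backwards.
      if (t :: t' :: R').map (List.flatMap (Side.subdivideSeam y z)) =
          (t ++ [head z]) :: (t' ++ [tail z]) :: R' ∧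
          head z ∉ (t :: t' :: R').flatten ∧ tail z ∉ (t :: t' :: R').flatten then
        t :: t' :: R' else W
    | _, _ => W

/-- Unite the ordinary edge `x` with the following one. -/
noncomputable def mergeEdgeAt (x : ℕ) (W : Polygons) : Polygons :=
  match focus (fwd x) W with
  | some (fwd z :: t, R) =>
    let V := ((fwd x :: t) :: R).map (List.filter (· ≠ bwd z))
    if V.map (List.flatMap (Side.subdivide x z)) = (fwd x :: fwd z :: t) :: R ∧
        edgeFree z V = true then V
    else W
  | _ => W

/-- The label of a seam. -/
def seamLabel : Side → Option ℕ
  | head y => some y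
  | tail y => some y
  | _ => none

/-- The labels given by `f`, in the order of first appearance. -/
def labels (f : Side → Option ℕ) (W : Polygons) : List ℕ := (W.flatten.filterMap f).eraseDups

/-- The order in which the sides are considered. -/
def sideKey : Side → ℕ
  | src e => e
  | tgt e => 100 + e
  | head _ => 200
  | tail _ => 200
  | fwd _ => 300
  | bwd _ => 300

/-- The least key of a side of a polygon. -/
def polygonKey (w : List Side) : ℕ := w.foldl (fun m s => min m (sideKey s)) 400

/-- List the sides of a polygon from the least one on. -/
def rotateMin (w : List Side) : List Side := w.rotate (w.findIdx fun s => sideKey s = polygonKey w)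

/-- Rename the seams in the order of their first appearance, from the `i`-th one on. -/
def renameSeams : ℕ → ℕ → Polygons → Polygons
  | 0, _, W => W
  | n + 1, i, W =>
    match (labels seamLabel W)[i]? with
    | none => W
    | some y => renameSeams n (i + 1)
        (if y = i then W else W.map (List.map (Side.relabel (Equiv.refl ℕ) (Equiv.swap i y))))

/-- Rename the ordinary edges in the order of their first appearance, from the `i`-th one on, and
direct them so that they first appear in forward direction. -/
def renameEdges : ℕ → ℕ → Polygons → Polygons
  | 0, _, W => W
  | n + 1, i, W =>
    match (labels edgeLabel W)[i]? with
    | none => W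
    | some x =>
      let V := if x = i then W else
        W.map (List.map (Side.relabel (Equiv.swap i x) (Equiv.refl ℕ)))
      renameEdges n (i + 1)
        (if V.flatten.find? (fun s => edgeLabel s = some i) = some (bwd i) then
          V.map (List.map (Side.turn i)) else V)

/-- Order the polygons and their sides, and rename the edges accordingly. -/
def canonical (W : Polygons) : Polygons :=
  let V := (W.map rotateMin).insertionSort fun v w => polygonKey v ≤ polygonKey w
  renameEdges V.flatten.length 0 (renameSeams V.flatten.length 0 V)

/-- Paste and fold along all edges, repeatedly. -/
noncomputable def pasteAll : ℕ → Polygons → Polygons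
  | 0, W => W
  | n + 1, W =>
    let V := (labels edgeLabel W).foldl (fun U x => pasteAt x U) W
    if V = W then W else pasteAll n V

/-- A neck: an edge `x` along which an annulus with the boundary words `u` and `v` has been cut,
together with the other polygons. -/
abbrev Neck := ℕ × List Side × List Side × Polygons

/-- The neck at the edge `x`. -/
noncomputable def neckAt (W : Polygons) (x : ℕ) : Option Neck :=
  (focus (fwd x) W).bind fun r =>
    if bwd x ∈ r.1 then
      some (x, r.1.take (r.1.idxOf (bwd x)), r.1.drop (r.1.idxOf (bwd x) + 1), r.2)
    else none

/-- The presentation of a surface with a neck. -/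
def Neck.polygons (N : Neck) : Polygons := ((fwd N.1 :: N.2.1) ++ (bwd N.1 :: N.2.2.1)) :: N.2.2.2

/-- Move the end points of the cut of a neck, at the edge `x`. -/
noncomputable def straightenAt (x : ℕ) (W : Polygons) : Polygons :=
  match neckAt W x with
  | none => W
  | some (x, u, v, R) =>
    if u.all (fun s => (edgeLabel s).isNone) ∧ edgeFree x (u :: v :: R) = true then
      Neck.polygons (x, rotateMin u, rotateMin v, R) else W

/-- A simplified presentation of the same surface. -/
noncomputable def normalize (W : Polygons) : Polygons :=
  let V := pasteAll 8 W
  let V := (labels seamLabel V).foldl (fun U z => mergeSeamAt z U) V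
  let V := canonical V
  let V := (labels edgeLabel V).foldl (fun U x => mergeEdgeAt x U) V
  let V := (labels edgeLabel V).foldl (fun U x => straightenAt x U) V
  canonical V

/-! ## Formal linear combinations of surfaces -/

/-- Formal linear combinations: the term `(c, n, W)` stands for `c * ω ^ n` times the surface
presented by `W`. -/
abbrev Comb := List (ℤ × ℕ × Polygons)

/-- The two sides of a seam. -/
inductive SeamSide where
  | heads
  | tails

/-- A way of using a relation for the surface `W`: the first component presents the same surface,
the second one is a surface to which it is equal up to the power of `ω` in the third component. -/
abbrev Rewrite := Polygons × Polygons × ℕ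

/-- Remove a closed seam which bounds a disc. -/
def removeDisc (W : Polygons) : Option Rewrite :=
  let x := fresh W
  match W.find? (fun w => w matches [head _] | [tail _]) with
  | some [head y] =>
    let R := W.erase [head y]
    some ([head y] :: R, [bwd x] :: R.map (List.map (Side.unseam y x)), 1)
  | some [tail y] =>
    let R := W.erase [tail y]
    -- The exponent 3 stands for ω⁻¹, since ω⁴ = 1.
    some ([tail y] :: R, [bwd x] :: R.map (List.map (Side.unseam y x)), 3)
  | _ => none

/-- Undo `Side.recouple`. -/
def Side.uncouple (y₁ y₂ a₁ a₂ x₁ x₂ z₁ z₂ : ℕ) : Side → Side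
  | fwd x => if x = x₁ then tail y₁ else if x = x₂ then tail y₂ else fwd x
  | head z => if z = z₁ then bwd a₁ else if z = z₂ then bwd a₂ else head z
  | s => s

/-- Is this a side of a seam of the given kind? -/
def SeamSide.test : SeamSide → Side → Bool
  | heads, head _ => true
  | tails, tail _ => true
  | _, _ => false

/-- Recouple the first two seams for which a polygon lies on the given side. -/
noncomputable def recoupleFirst (κ : SeamSide) (W : Polygons) : Option Rewrite := do
  let w ← W.find? fun w => 2 ≤ (w.filter κ.test).length
  let s ← (w.filter κ.test)[0]?
  let s' ← (w.filter κ.test)[1]?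
  let (t, R) ← focus s W
  let u := t.takeWhile (· ≠ s')
  let v := (t.dropWhile (· ≠ s')).tail
  let n := fresh W
  match s, s' with
  | head y₁, head y₂ =>
    -- The polygon is cut along two new edges into the rectangle between the two seam sides and the
    -- two remaining pieces, which brings the surface into the form required by the relation.
    let V := (bwd n :: u) :: (bwd (n + 1) :: v) :: R
    some ([head y₁, fwd n, head y₂, fwd (n + 1)] :: V,
      [tail (n + 1), bwd (n + 3), tail n, bwd (n + 2)] ::
        V.map (List.map (Side.recouple y₁ y₂ n (n + 1) (n + 2) (n + 3) n (n + 1))), 3)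
  | tail z₂, tail z₁ =>
    -- Here the relation is read from right to left. `Side.uncouple` prepares the other polygons so
    -- that `Side.recouple` reproduces the given surface, and the factor becomes ω.
    let V := ((fwd (n + 3) :: u) :: (fwd (n + 2) :: v) :: R).map
      (List.map (Side.uncouple n (n + 1) n (n + 1) (n + 2) (n + 3) z₁ z₂))
    some ([tail z₂, bwd (n + 3), tail z₁, bwd (n + 2)] ::
        V.map (List.map (Side.recouple n (n + 1) n (n + 1) (n + 2) (n + 3) z₁ z₂)),
      [head n, fwd n, head (n + 1), fwd (n + 1)] :: V, 1)
  | _, _ => none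

/-- Simplify the surface by removing closed seams and, if `κ` is given, by recoupling. -/
noncomputable def reduce (X Y : GrTangle p q) (κ : Option SeamSide) : ℕ → ℤ × ℕ × Polygons → Comb
  | 0, t => [t]
  | m + 1, (c, n, W₀) =>
    let W := normalize W₀
    if validTest X Y W = true then
      match (labels edgeLabel W).find? fun x => [fwd x, bwd x] ∈ W with
      | some x =>
        if validTest X Y ([fwd x, bwd x] :: W.erase [fwd x, bwd x]) = true then []
        else [(c, n, W)]
      | none =>
        match (removeDisc W).orElse fun _ => κ.bind fun κ => recoupleFirst κ W with
        | none => [(c, n, W)]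
        | some (S, T, e) =>
          -- Having normal form `W` certifies that `S` presents the surface at hand, so the cutting
          -- in `recoupleFirst` needs no separate justification.
          if normalize S = W ∧ validTest X Y S = true ∧ validTest X Y T = true then
            reduce X Y κ m (c, (n + e) % 4, T) else [(c, n, W)]
    else [(c, n, W₀)]

/-- The neck to be cut: a neck ending at a closed seam on the given side, if possible. -/
noncomputable def findNeck (κ : SeamSide) (W : Polygons) : Option Neck :=
  let l := (labels edgeLabel W).filterMap (neckAt W)
  (l.find? fun N => (N.2.1.length = 1 ∧ N.2.1.all κ.test) ∨
    (N.2.2.1.length = 1 ∧ N.2.2.1.all κ.test)).orElse fun _ => l.head?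

/-- Twice the given surface, after cutting a neck. -/
noncomputable def cutNeck (X Y : GrTangle p q) (κ : SeamSide) (t : ℤ × ℕ × Polygons) : Comb :=
  match findNeck κ t.2.2 with
  | none => [(2 * t.1, t.2)]
  | some N =>
    let n := fresh t.2.2
    let T := (N.2.1 ++ handle N.1 n) :: N.2.2.1 :: N.2.2.2
    let T' := N.2.1 :: (N.2.2.1 ++ handle N.1 n) :: N.2.2.2
    if N.2.1 ≠ [] ∧ N.2.2.1 ≠ [] ∧ validTest X Y N.polygons = true ∧
        validTest X Y T = true ∧ validTest X Y T' = true then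
      -- Neck cutting multiplied by 2, which keeps the coefficients integral.
      [(t.1, t.2.1, T), (t.1, t.2.1, T')]
    else [(2 * t.1, t.2)]

/-- The way in which surfaces are simplified: by recoupling their seams as indicated, and possibly
by cutting a neck. -/
abbrev Mode := Option (SeamSide × Bool)

/-- Twice the given multiple of a surface, simplified. -/
noncomputable def expand (X Y : GrTangle p q) (μ : Mode) (t : ℤ × ℕ × Polygons) : Comb :=
  match μ with
  | some (κ, true) =>
    -- The bound 12 limits the number of rewriting steps; stopping early is sound, as the remaining
    -- term is returned.
    ((reduce X Y (some κ) 12 t).flatMap (cutNeck X Y κ)).flatMap (reduce X Y none 12)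
  | _ => (reduce X Y (μ.map Prod.fst) 12 t).map fun t => (2 * t.1, t.2)

/-- Do all coefficients of the linear combination vanish, up to `ω ^ 4 = 1`? -/
def cancels : ℕ → Comb → Bool
  | _, [] => true
  | 0, _ :: _ => false
  | m + 1, t :: C =>
    let p : ℤ × ℕ × Polygons → Bool := fun s => s.2.1 % 4 = t.2.1 % 4 ∧ s.2.2 = t.2.2
    (((t :: C).filter p).map Prod.fst).sum = 0 && cancels m (C.filter fun s => !p s)

/-- Does the linear combination represent zero? -/
noncomputable def vanishes (X Y : GrTangle p q) (μ : Mode) (C : Comb) : Bool :=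
  C.all (fun t => validTest X Y t.2.2) &&
    let E := C.flatMap (expand X Y μ)
    cancels E.length E

/-! ## Matrices of formal linear combinations, indexed by the vertices of the cube -/

/-- A matrix of formal linear combinations. -/
abbrev CombMat := Resolution 3 → Resolution 3 → Comb

/-- The vertices of the cube. -/
def vertices : List (Resolution 3) :=
  [![false, false, false], ![true, false, false], ![false, true, false], ![false, false, true],
    ![true, true, false], ![true, false, true], ![false, true, true], ![true, true, true]]

/-- The product of matrices. -/
def CombMat.mul (A B : CombMat) : CombMat := fun v w =>
  vertices.flatMap fun u => (A v u).flatMap fun s => (B u w).map fun t =>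
    (s.1 * t.1, s.2.1 + t.2.1, glue s.2.2 t.2.2)

/-- The negative of a linear combination. -/
def Comb.neg (C : Comb) : Comb := C.map fun t => (-t.1, t.2)

/-- The matrix of the differential of a cube. -/
def diffMat (D : Diagram 3 3 3) : CombMat := fun v w =>
  (List.finRange 3).flatMap fun c =>
    if Diagram.IsEdge v w c then
      [((-1) ^ (Finset.univ.filter fun j => c < j ∧ v j).card, 0, D.saddlePolygons v c)] else []

/-- The identity matrix. -/
def oneMat (D : Diagram 3 3 3) : CombMat := fun v w =>
  if v = w then [(1, 0, cylinder (D.smoothing v))] else []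

end Disoriented

namespace Disoriented
open Side

/-! ## The chain map, its homotopy inverse and the homotopies as formal matrices -/

/-- The chain map. -/
def r3Mat : CombMat := fun v w =>
  match r3Polygons v w with
  | none => []
  | some W =>
    match v 0, v 1, v 2, w 0, w 1, w 2 with
    | true, true, false, true, false, true => [(1, 2, W)]
    | true, false, true, true, false, true => [(-1, 2, W)]
    | false, true, true, true, false, true => [(1, 2, W)]
    | true, false, true, false, true, true => [(-1, 0, W)]
    | _, _, _, _, _, _ => [(1, 0, W)]

/-- The homotopy inverse. -/
def r3InvMat : CombMat := fun v w =>
  match v 0, v 1, v 2, w 0, w 1, w 2 with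
  | false, false, false, false, false, false =>
    [(1, 0, [[src 0, tgt 0, tgt 6, tgt 3, src 3], [src 1, tgt 1, tgt 7, tgt 8, tgt 4, src 4,
      src 8, src 6], [src 2, tgt 2, tgt 5, src 5, src 7]])]
  | false, true, false, false, false, true =>
    [(1, 0, [[src 0, tgt 0, tail 0], [src 1, tgt 1, head 0, src 6], [src 2, tgt 2, tgt 5, src 5,
      src 7], [src 3, tail 1, tgt 6, tgt 3], [src 4, src 8, head 1, tgt 7, tgt 8, tgt 4]])]
  | false, true, false, false, true, false =>
    [(1, 0, [[src 0, tgt 0, tgt 6, tail 0], [src 1, tgt 1, tgt 7, tgt 8, head 0, src 6], [src 2,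
      tgt 2, tgt 5, src 5, src 7], [src 3, tail 1, tgt 3], [src 4, src 8, head 1, tgt 4]])]
  | false, true, true, false, true, true =>
    [(-1, 2, [[src 0, tgt 0, tail 0], [src 1, tgt 1, head 0, src 6], [src 2, tgt 2, tgt 5, src 5,
      head 1, src 7], [src 3, tail 2, tgt 3], [src 4, tail 1, src 8, head 2, tgt 4], [tgt 6,
      tail 3], [tgt 7, tgt 8, head 3]])]
  | false, true, true, true, false, true =>
    [(-1, 0, [[src 0, tgt 0, tail 0], [src 1, tgt 1, head 0, src 6], [src 2, tgt 2, head 1,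
      src 7], [src 3, tail 2, tgt 6, tgt 3], [src 4, tail 3, tgt 8, tgt 4], [src 5, head 3,
      tgt 5], [src 8, head 2, tgt 7, tail 1]])]
  | true, false, false, true, false, false =>
    [(1, 0, [[src 0, tgt 0, tgt 6, tgt 3, src 3], [src 1, tgt 1, tgt 7, tail 0], [src 2, tgt 2,
      head 0], [src 4, src 8, src 6, tail 1, tgt 8, tgt 4], [src 5, src 7, head 1, tgt 5]])]
  | true, false, true, false, true, true =>
    [(1, 2, [[src 0, tgt 0, tail 0, tgt 3, src 3], [src 1, tgt 1, head 0, tgt 4, src 4, tail 1],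
      [src 2, tgt 2, tgt 5, src 5, head 1], [src 6, tail 2, src 8], [src 7, head 2], [tgt 6,
      tail 3], [tgt 7, tgt 8, head 3]])]
  | true, false, true, true, false, true =>
    [(1, 0, [[src 0, tgt 0, tail 0, tgt 6, tgt 3, src 3], [src 1, tgt 1, head 0, tgt 7, tail 1],
      [src 2, tgt 2, head 1], [src 4, tail 2, tgt 8, tgt 4], [src 5, head 2, tgt 5], [src 6,
      tail 3, src 8], [src 7, head 3]])]
  | true, true, false, false, true, true =>
    [(-1, 2, [[src 0, tgt 0, tail 0], [src 1, tgt 1, head 0, src 6, tail 1], [src 2, tgt 2,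
      tgt 5, src 5, src 7, head 1], [src 3, tail 2, tgt 3], [src 4, src 8, head 2, tgt 4],
      [tgt 6, tail 3], [tgt 7, tgt 8, head 3]])]
  | true, true, false, true, true, false =>
    [(1, 0, [[src 0, tgt 0, tgt 6, tail 0], [src 1, tgt 1, tgt 7, tail 1], [src 2, tgt 2,
      head 1], [src 3, tail 2, tgt 3], [src 4, src 8, head 2, tgt 4], [src 5, src 7, head 3,
      tgt 5], [src 6, tail 3, tgt 8, head 0]])]
  | _, _, _, _, _, _ => []

/-- The homotopy on the complex of the initial tangle: the circle is capped off or created. -/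
def initialHomotopy : CombMat := fun v w =>
  match v 0, v 1, v 2, w 0, w 1, w 2 with
  -- The saddle 001 → 011 has sign -1, and capping off the circle it creates gives back the product;
  -- hence the coefficient -1.
  | false, true, true, false, false, true =>
    [(-1, 0, [[src 0, tgt 0, tail 0], [src 1, tgt 1, head 0], [src 2, tgt 2, tgt 5, src 5],
      [src 3, tail 1, tgt 6, tgt 3], [src 4, head 1, tgt 7, tgt 8, tgt 4], [src 6, tail 2],
      [src 7, head 2, src 8]])]
  -- Followed by the saddle 011 → 111, of sign +1, this has to be the identity. The factor ω²
  -- offsets the powers of ω that arise from the seams.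
  | true, true, true, false, true, true =>
    [(1, 2, [[src 0, tgt 0, tail 0], [src 1, tgt 1, head 0], [src 2, tgt 2, tgt 5, src 5,
      head 1], [src 3, tail 2, tgt 3], [src 4, head 2, tgt 4], [src 6, tail 3], [src 7, head 3,
      src 8, tail 1], [tgt 6, tail 4], [tgt 7, tgt 8, head 4]])]
  | _, _, _, _, _, _ => []

/-- The homotopy on the complex of the final tangle: the circle is capped off or created. -/
def finalHomotopy : CombMat := fun v w =>
  match v 0, v 1, v 2, w 0, w 1, w 2 with
  | true, false, true, false, false, true =>
    [(-1, 0, [[src 0, tgt 0, tgt 3, src 3], [src 1, tgt 1, tgt 6, tgt 8, tail 0], [src 2, tgt 2,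
      tgt 7, head 0], [src 4, tail 1, tgt 4], [src 5, head 1, tgt 5], [src 6, tail 2, src 8],
      [src 7, head 2]])]
  | true, true, true, true, false, true =>
    [(-1, 2, [[src 0, tgt 0, tgt 3, src 3, tail 0], [src 1, tgt 1, tail 1], [src 2, tgt 2,
      head 1], [src 4, tail 2, tgt 4], [src 5, head 2, tgt 5], [src 6, tail 3, src 8, head 0],
      [src 7, head 3], [tgt 6, tgt 8, tail 4], [tgt 7, head 4]])]
  | _, _, _, _, _, _ => []


/-! ## Normal forms present the same surface -/

theorem Fast.all_eq {α : Type} (f : α → Bool) (l : List α) : Fast.all f l = l.all f := by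
  induction l with
  | nil => rfl
  | cons a l ih =>
    have : Fast.all f (a :: l) = bif f a then Fast.all f l else false := rfl
    rw [this, ih, List.all_cons]
    cases f a <;> rfl

theorem edgeFree_iff {x : ℕ} {W : Polygons} :
    edgeFree x W = true ↔ fwd x ∉ W.flatten ∧ bwd x ∉ W.flatten := by
  have h : ∀ s : Side, avoids x s = true ↔ s ≠ fwd x ∧ s ≠ bwd x := by
    intro s
    cases s <;> simp [avoids, ← Bool.not_eq_true, Nat.beq_eq]
  simp only [edgeFree, Fast.all_eq, List.all_eq_true, h, List.mem_flatten]
  constructor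
  · exact fun H => ⟨fun ⟨w, hw, hs⟩ => (H w hw _ hs).1 rfl, fun ⟨w, hw, hs⟩ => (H w hw _ hs).2 rfl⟩
  · rintro ⟨h1, h2⟩ w hw s hs
    exact ⟨fun h => h1 ⟨w, hw, h ▸ hs⟩, fun h => h2 ⟨w, hw, h ▸ hs⟩⟩

/-! ### Changes of presentation derived from the elementary ones. -/

namespace Equivalent

theorem refl (W : Polygons) : Equivalent W W := Relation.EqvGen.refl W

theorem symm {W W' : Polygons} (h : Equivalent W W') : Equivalent W' W := Relation.EqvGen.symm _ _ h

theorem trans {W W' W'' : Polygons} (h : Equivalent W W') (h' : Equivalent W' W'') :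
    Equivalent W W'' := Relation.EqvGen.trans _ _ _ h h'

theorem of_move {W W' : Polygons} (h : Move W W') : Equivalent W W' := Relation.EqvGen.rel _ _ h

theorem of_perm {W W' : Polygons} (h : W.Perm W') : Equivalent W W' := of_move (Move.reorder h)

theorem of_isRotated {w w' : List Side} (h : w ~r w') (W : Polygons) :
    Equivalent (w :: W) (w' :: W) := by
  obtain ⟨n, rfl⟩ := h
  rw [List.rotate_eq_drop_append_take_mod]
  have h := Move.rotate (w.take (n % w.length)) (w.drop (n % w.length)) W
  rw [List.take_append_drop] at h
  exact of_move h

theorem of_perm_isRotated {w w' : List Side} {W R : Polygons} (h : W.Perm (w :: R))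
    (h' : w ~r w') : Equivalent W (w' :: R) :=
  (of_perm h).trans (of_isRotated h' R)

theorem of_isRotated_second {w w' : List Side} (h : w ~r w') (v : List Side) (W : Polygons) :
    Equivalent (v :: w :: W) (v :: w' :: W) :=
  (of_perm (List.Perm.swap _ _ _)).trans
    ((of_isRotated h _).trans (of_perm (List.Perm.swap _ _ _)))

theorem map_of_isRotated (f : List Side → List Side) (hf : ∀ w, w ~r f w) (W : Polygons) :
    Equivalent W (W.map f) := by
  -- Moves act on the first polygon. The polygons are therefore rotated one at a time and passed on
  -- to `V`.
  have h : ∀ W V : Polygons, Equivalent (W ++ V) (W.map f ++ V) := by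
    intro W
    induction W with
    | nil => intro V; exact refl V
    | cons w W ih =>
      intro V
      refine (of_isRotated (hf w) _).trans ?_
      refine (of_perm (List.perm_middle (l₁ := W)).symm).trans ?_
      exact (ih _).trans (of_perm List.perm_middle)
  simpa using h W []

theorem paste {x : ℕ} {u v : List Side} {W : Polygons} (h : u ++ v ≠ [])
    (hx : edgeFree x ((u ++ v) :: W) = true) :
    Equivalent ((fwd x :: u) :: (bwd x :: v) :: W) ((u ++ v) :: W) := by
  rw [edgeFree_iff] at hx
  exact (of_isRotated ⟨1, by simp⟩ _).trans (of_move (Move.paste x u v W h hx.1 hx.2))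

theorem _root_.Disoriented.turn_eq_of_not_mem {x : ℕ} {l : List Side} (h : fwd x ∉ l)
    (h' : bwd x ∉ l) : l.map (Side.turn x) = l := by
  refine List.map_congr_left (g := id) (fun s hs => ?_) |>.trans (List.map_id _)
  cases s <;> simp only [Side.turn, id] <;> split_ifs <;> simp_all

theorem _root_.Disoriented.map_turn_eq {x : ℕ} {W : Polygons} (h : edgeFree x W = true) :
    W.map (List.map (Side.turn x)) = W := by
  rw [edgeFree_iff] at h
  refine List.map_congr_left (g := id) (fun w hw => ?_) |>.trans (List.map_id _)
  exact turn_eq_of_not_mem (fun h' => h.1 (List.mem_flatten.2 ⟨w, hw, h'⟩))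
    (fun h' => h.2 (List.mem_flatten.2 ⟨w, hw, h'⟩))

theorem fold {x : ℕ} {u : List Side} {W : Polygons} (h : u ≠ [])
    (hx : edgeFree x (u :: W) = true) : Equivalent ((fwd x :: bwd x :: u) :: W) (u :: W) := by
  rw [edgeFree_iff] at hx
  exact of_move (Move.fold x u W h hx.1 hx.2)

theorem fold' {x : ℕ} {u : List Side} {W : Polygons} (h : u ≠ [])
    (hx : edgeFree x (u :: W) = true) : Equivalent ((bwd x :: fwd x :: u) :: W) (u :: W) := by
  refine (of_move (Move.turn x _)).trans ?_
  have := map_turn_eq hx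
  rw [List.map_cons, List.cons.injEq] at this
  simp only [List.map_cons, this.1, this.2, Side.turn, if_true]
  exact fold h hx

theorem _root_.Disoriented.exists_edgeFree (W : Polygons) (x : ℕ) :
    ∃ z, z ≠ x ∧ edgeFree z W = true := by
  obtain ⟨z, hz⟩ := Infinite.exists_notMem_finset
    (insert x (W.flatten.filterMap edgeLabel).toFinset)
  simp only [Finset.mem_insert, List.mem_toFinset, List.mem_filterMap, not_or, not_exists,
    not_and] at hz
  refine ⟨z, hz.1, edgeFree_iff.2 ⟨fun h => hz.2 _ h rfl, fun h => hz.2 _ h rfl⟩⟩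

theorem _root_.Disoriented.subdivide_eq_of_not_mem {x z : ℕ} {l : List Side} (h : fwd x ∉ l)
    (h' : bwd x ∉ l) : l.flatMap (Side.subdivide x z) = l := by
  induction l with
  | nil => rfl
  | cons s l ih =>
    simp only [List.mem_cons, not_or] at h h'
    rw [List.flatMap_cons, ih h.2 h'.2]
    cases s <;> simp only [Side.subdivide, List.singleton_append] <;> split_ifs <;> simp_all

/-- Two discs which are glued along their whole boundary form a sphere. -/
theorem sphere {x : ℕ} {W : Polygons} (hx : edgeFree x W = true) :
    Equivalent ([fwd x] :: [bwd x] :: W) ([fwd x, bwd x] :: W) := by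
  obtain ⟨z, hzx, hz⟩ := exists_edgeFree W x
  have hx' := edgeFree_iff.1 hx
  have hz' := edgeFree_iff.1 hz
  -- Pasting along `x` would leave an empty polygon, which `Move.paste` forbids. Subdividing `x`
  -- first allows pasting along the new half `z`.
  have h1 : Equivalent ([fwd x] :: [bwd x] :: W)
      (([fwd x] :: [bwd x] :: W).map (List.flatMap (Side.subdivide x z))) := by
    refine of_move (Move.subdivide x z _ ?_ ?_) <;> simp_all
  refine h1.trans ?_
  have h2 : W.map (List.flatMap (Side.subdivide x z)) = W := by
    refine List.map_congr_left (g := id) (fun w hw => ?_) |>.trans (List.map_id _)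
    exact subdivide_eq_of_not_mem (fun h' => hx'.1 (List.mem_flatten.2 ⟨w, hw, h'⟩))
      (fun h' => hx'.2 (List.mem_flatten.2 ⟨w, hw, h'⟩))
  simp only [List.map_cons, h2, List.flatMap_cons, Side.subdivide, if_true, List.flatMap_nil,
    List.append_nil]
  refine of_move (Move.paste z [fwd x] [bwd x] W (by simp) ?_ ?_) <;> simp_all

end Equivalent

/-! ### Soundness of the simplification of presentations. -/

theorem focus_spec {s : Side} {W : Polygons} {t : List Side} {R : Polygons}
    (h : focus s W = some (t, R)) : ∃ w, w ~r (s :: t) ∧ W.Perm (w :: R) := by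
  induction W generalizing R with
  | nil => simp [focus] at h
  | cons w W ih =>
    have key : (focus s W).map (fun r => (r.1, w :: r.2)) = some (t, R) →
        ∃ v, v ~r (s :: t) ∧ (w :: W).Perm (v :: R) := by
      intro h
      obtain ⟨⟨t', R'⟩, h1, h2⟩ := Option.map_eq_some_iff.1 h
      simp only [Prod.mk.injEq] at h2
      obtain ⟨rfl, rfl⟩ := h2
      obtain ⟨v, hv, hp⟩ := ih h1
      exact ⟨v, hv, (hp.cons w).trans (List.Perm.swap _ _ _)⟩
    rw [focus] at h
    split at h
    · exact key h
    · rename_i s' t' hr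
      rcases hs : Nat.beq s'.code s.code with _ | _
      · rw [hs, cond_false] at h
        exact key h
      · rw [hs, cond_true, Option.some.injEq, Prod.mk.injEq] at h
        obtain ⟨rfl, rfl⟩ := h
        obtain rfl := code_injective (Nat.eq_of_beq_eq_true hs)
        exact ⟨w, ⟨_, hr⟩, List.Perm.refl _⟩

theorem focus_equivalent {s : Side} {W : Polygons} {t : List Side} {R : Polygons}
    (h : focus s W = some (t, R)) : Equivalent W ((s :: t) :: R) := by
  obtain ⟨w, hw, hp⟩ := focus_spec h
  exact Equivalent.of_perm_isRotated hp hw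

theorem focus_equivalent_second {s : Side} {W : Polygons} {t : List Side} {R : Polygons}
    (h : focus s W = some (t, R)) (v : List Side) : Equivalent (v :: W) (v :: (s :: t) :: R) := by
  obtain ⟨w, hw, hp⟩ := focus_spec h
  exact (Equivalent.of_perm (hp.cons v)).trans (Equivalent.of_isRotated_second hw _ _)

/-- A change occurs only where `paste`, `sphere`, `fold` or `fold'` applies; the tests by `edgeFree`
are their freshness conditions. -/
theorem pasteAt_equivalent (x : ℕ) (W : Polygons) : Equivalent W (pasteAt x W) := by
  rw [pasteAt]
  split
  · exact Equivalent.refl W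
  rename_i t R hf
  have h1 := focus_equivalent hf
  split
  · rename_i t' R' hb
    have h2 := h1.trans (focus_equivalent_second hb _)
    split_ifs with h3
    · rcases h4 : edgeFree x ((t ++ t') :: R') with _ | _
      · exact Equivalent.refl W
      · exact h2.trans (Equivalent.paste h3 h4)
    · rcases h4 : edgeFree x R' with _ | _
      · exact Equivalent.refl W
      · simp only [ne_eq, not_not, List.append_eq_nil_iff] at h3
        obtain ⟨rfl, rfl⟩ := h3
        exact h2.trans (Equivalent.sphere h4)
  · split_ifs with h2 h3
    · obtain ⟨h2, h3, h4⟩ := h2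
      obtain ⟨u, rfl⟩ : ∃ u, t = bwd x :: u := by
        rcases t with _ | ⟨s, u⟩
        · simp at h2
        · simp only [List.head?_cons, Option.some.injEq] at h2
          exact ⟨u, by rw [h2]⟩
      exact h1.trans (Equivalent.fold h3 h4)
    · obtain ⟨h2, h3, h4⟩ := h3
      obtain ⟨u, rfl⟩ : ∃ u, t = u ++ [bwd x] := by
        obtain ⟨u, hu⟩ := List.getLast?_eq_some_iff.1 h2
        exact ⟨u, hu⟩
      rw [List.dropLast_concat] at h3 h4 ⊢
      refine h1.trans (Equivalent.trans ?_ (Equivalent.fold' h3 h4))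
      refine (Equivalent.of_isRotated (List.IsRotated.symm ⟨1, ?_⟩) _)
      simp
    · exact Equivalent.refl W

theorem foldl_equivalent (f : Polygons → ℕ → Polygons) (hf : ∀ W x, Equivalent W (f W x))
    (l : List ℕ) (W : Polygons) : Equivalent W (l.foldl f W) := by
  induction l generalizing W with
  | nil => exact Equivalent.refl W
  | cons x l ih => exact (hf W x).trans (ih _)

theorem pasteAll_equivalent (n : ℕ) (W : Polygons) : Equivalent W (pasteAll n W) := by
  induction n generalizing W with
  | zero => exact Equivalent.refl W
  | succ n ih =>
    have h := foldl_equivalent (fun U x => pasteAt x U) (fun U x => pasteAt_equivalent x U)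
      (labels edgeLabel W) W
    rw [pasteAll]
    split_ifs
    · exact Equivalent.refl W
    · exact h.trans (ih _)

theorem mergeSeamAt_equivalent (z : ℕ) (W : Polygons) : Equivalent W (mergeSeamAt z W) := by
  rw [mergeSeamAt]
  split
  · exact Equivalent.refl W
  rename_i t R hf
  split
  · rename_i t' R' y hb hy
    split_ifs with h
    · obtain ⟨h1, h2, h3⟩ := h
      have h4 : Equivalent W ((t ++ [head z]) :: (t' ++ [tail z]) :: R') := by
        refine (focus_equivalent hf).trans ((focus_equivalent_second hb _).trans ?_)
        refine (Equivalent.of_isRotated ⟨1, ?_⟩ _).trans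
          (Equivalent.of_isRotated_second ⟨1, ?_⟩ _ _)
        · simp
        · simp
      rw [← h1] at h4
      exact h4.trans (Equivalent.of_move (Move.subdivideSeam y z _ h2 h3)).symm
    · exact Equivalent.refl W
  · exact Equivalent.refl W

theorem mergeEdgeAt_equivalent (x : ℕ) (W : Polygons) : Equivalent W (mergeEdgeAt x W) := by
  rw [mergeEdgeAt]
  split
  · rename_i z t R hf
    simp only
    split_ifs with h
    · obtain ⟨h1, h2⟩ := h
      rw [edgeFree_iff] at h2
      have h3 := focus_equivalent hf
      rw [← h1] at h3
      exact h3.trans (Equivalent.of_move (Move.subdivide x z _ h2.1 h2.2)).symm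
    · exact Equivalent.refl W
  · exact Equivalent.refl W

theorem renameSeams_equivalent (n i : ℕ) (W : Polygons) : Equivalent W (renameSeams n i W) := by
  induction n generalizing i W with
  | zero => exact Equivalent.refl W
  | succ n ih =>
    rw [renameSeams]
    split
    · exact Equivalent.refl W
    · refine Equivalent.trans ?_ (ih _ _)
      split_ifs
      · exact Equivalent.refl W
      · exact Equivalent.of_move (Move.relabel _ _ _)

theorem renameEdges_equivalent (n i : ℕ) (W : Polygons) : Equivalent W (renameEdges n i W) := by
  induction n generalizing i W with
  | zero => exact Equivalent.refl W
  | succ n ih =>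
    rw [renameEdges]
    split
    · exact Equivalent.refl W
    · rename_i x _
      have h : Equivalent W (if x = i then W else
          W.map (List.map (Side.relabel (Equiv.swap i x) (Equiv.refl ℕ)))) := by
        split_ifs
        · exact Equivalent.refl W
        · exact Equivalent.of_move (Move.relabel _ _ _)
      refine h.trans (Equivalent.trans ?_ (ih _ _))
      split_ifs
      · exact Equivalent.of_move (Move.turn _ _)
      · exact Equivalent.refl _
      · exact Equivalent.of_move (Move.turn _ _)
      · exact Equivalent.refl _

theorem isRotated_rotateMin (w : List Side) : w ~r rotateMin w := ⟨_, rfl⟩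

theorem canonical_equivalent (W : Polygons) : Equivalent W (canonical W) := by
  rw [canonical]
  refine Equivalent.trans ?_ (renameEdges_equivalent _ _ _)
  refine Equivalent.trans ?_ (renameSeams_equivalent _ _ _)
  exact (Equivalent.map_of_isRotated _ isRotated_rotateMin W).trans
    (Equivalent.of_perm (List.perm_insertionSort _ _).symm)

theorem neckAt_equivalent {W : Polygons} {x : ℕ} {N : Neck} (h : neckAt W x = some N) :
    Equivalent W N.polygons := by
  obtain ⟨⟨t, R⟩, h1, h2⟩ := Option.bind_eq_some_iff.1 h
  split_ifs at h2 with h3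
  simp only [Option.some.injEq] at h2
  subst h2
  have h4 := focus_equivalent h1
  have h5 : t.idxOf (bwd x) < t.length := List.idxOf_lt_length_iff.2 h3
  have h6 : t = t.take (t.idxOf (bwd x)) ++ (bwd x :: t.drop (t.idxOf (bwd x) + 1)) := by
    have h7 : t.drop (t.idxOf (bwd x)) = bwd x :: t.drop (t.idxOf (bwd x) + 1) := by
      rw [List.drop_eq_getElem_cons h5, List.getElem_idxOf]
    rw [← h7, List.take_append_drop]
  rw [Neck.polygons, List.cons_append, ← h6]
  exact h4

/-- The end point of a cut of a neck can be moved along the boundary of the neck. -/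
theorem Equivalent.slide {x d : ℕ} {u v w : List Side} {W : Polygons}
    (hx : edgeFree x (u :: v :: w :: W) = true) (hd : edgeFree d (u :: v :: w :: W) = true)
    (hdx : d ≠ x) :
    Equivalent ((fwd x :: u ++ v ++ bwd x :: w) :: W) ((fwd d :: w ++ bwd d :: (v ++ u)) :: W) := by
  rw [edgeFree_iff] at hx hd
  simp only [List.flatten_cons, List.mem_append, not_or] at hx hd
  -- The polygon is cut along a new edge `d` that separates `u` from `v`, and is then pasted along
  -- `x`. This moves one end of the cut and interchanges the two boundary words of the neck.
  have h1 : Equivalent ((fwd d :: (fwd x :: u)) :: (bwd d :: (v ++ bwd x :: w)) :: W)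
      ((fwd x :: u ++ v ++ bwd x :: w) :: W) := by
    have := Equivalent.paste (x := d) (u := fwd x :: u) (v := v ++ bwd x :: w) (W := W) (by simp)
      (by rw [edgeFree_iff]; simp [hd, hdx])
    simpa using this
  refine h1.symm.trans ?_
  have h2 : Equivalent ((fwd d :: (fwd x :: u)) :: (bwd d :: (v ++ bwd x :: w)) :: W)
      ((fwd x :: (u ++ [fwd d])) :: (bwd x :: (w ++ (bwd d :: v))) :: W) := by
    refine (Equivalent.of_isRotated ⟨1, ?_⟩ _).trans
      (Equivalent.of_isRotated_second ⟨v.length + 1, ?_⟩ _ _)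
    · simp
    · rw [← List.cons_append, List.rotate_eq_drop_append_take (by simp)]
      simp
  refine h2.trans ((Equivalent.paste (by simp) ?_).trans
    (Equivalent.of_isRotated ⟨u.length, ?_⟩ _))
  · rw [edgeFree_iff]
    simp [hx, Ne.symm hdx]
  · rw [List.append_assoc, List.rotate_append_length_eq]
    simp

theorem Equivalent.slide_isRotated {x d : ℕ} {u u' v : List Side} {W : Polygons} (h : u ~r u')
    (hx : edgeFree x (u :: v :: W) = true) (hd : edgeFree d (u :: v :: W) = true) (hdx : d ≠ x) :
    Equivalent ((fwd x :: u ++ bwd x :: v) :: W) ((fwd d :: v ++ bwd d :: u') :: W) := by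
  obtain ⟨n, rfl⟩ := h
  rw [List.rotate_eq_drop_append_take_mod]
  generalize n % u.length = m
  rw [edgeFree_iff] at hx hd
  have h := Equivalent.slide (x := x) (d := d) (u := u.take m) (v := u.drop m) (w := v) (W := W)
    (by
      rw [edgeFree_iff]
      simpa only [List.flatten_cons, ← List.append_assoc, List.take_append_drop] using hx)
    (by
      rw [edgeFree_iff]
      simpa only [List.flatten_cons, ← List.append_assoc, List.take_append_drop] using hd) hdx
  rw [List.cons_append, List.take_append_drop] at h
  exact h

theorem edgeFree_of_perm {x : ℕ} {W W' : Polygons} (h : W.flatten.Perm W'.flatten)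
    (hx : edgeFree x W = true) : edgeFree x W' = true := by
  rw [edgeFree_iff] at hx ⊢
  rwa [← h.mem_iff, ← h.mem_iff]

/-- The end points of a cut of a neck can be moved. -/
theorem Equivalent.straighten {x : ℕ} {u u' v v' : List Side} {W : Polygons} (hu : u ~r u')
    (hv : v ~r v') (hx : edgeFree x (u :: v :: W) = true) :
    Equivalent (Neck.polygons (x, u, v, W)) (Neck.polygons (x, u', v', W)) := by
  obtain ⟨d, hdx, hd⟩ := exists_edgeFree (u :: v :: W) x
  have h : (u :: v :: W).flatten.Perm (v :: u' :: W).flatten := by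
    simp only [List.flatten_cons, ← List.append_assoc]
    exact (List.perm_append_comm.trans (hu.perm.append_left v)).append_right _
  -- Each slide rotates one boundary word and exchanges the two. Two slides rotate both words and
  -- restore their order and the label `x`.
  exact (Equivalent.slide_isRotated hu hx hd hdx).trans (Equivalent.slide_isRotated hv
    (edgeFree_of_perm h hd) (edgeFree_of_perm h hx) (Ne.symm hdx))

theorem straightenAt_equivalent (x : ℕ) (W : Polygons) : Equivalent W (straightenAt x W) := by
  rw [straightenAt]
  split
  · exact Equivalent.refl W
  · rename_i x u v R h
    split_ifs with h1
    · exact (neckAt_equivalent h).trans (Equivalent.straighten (isRotated_rotateMin u)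
        (isRotated_rotateMin v) h1.2)
    · exact Equivalent.refl W

/-- Every stage is a chain of moves. That equivalent surfaces have equal normal forms is not
claimed: it is only observed in the cases computed. -/
theorem normalize_equivalent (W : Polygons) : Equivalent W (normalize W) := by
  have h1 : ∀ V, Equivalent V ((labels seamLabel V).foldl (fun U z => mergeSeamAt z U) V) :=
    fun V => foldl_equivalent _ (fun U z => mergeSeamAt_equivalent z U) _ V
  have h2 : ∀ V, Equivalent V ((labels edgeLabel V).foldl (fun U x => mergeEdgeAt x U) V) :=
    fun V => foldl_equivalent _ (fun U x => mergeEdgeAt_equivalent x U) _ V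
  have h3 : ∀ V, Equivalent V ((labels edgeLabel V).foldl (fun U x => straightenAt x U) V) :=
    fun V => foldl_equivalent _ (fun U x => straightenAt_equivalent x U) _ V
  exact (pasteAll_equivalent 8 W).trans ((h1 _).trans ((canonical_equivalent _).trans
    ((h2 _).trans ((h3 _).trans (canonical_equivalent _)))))

end Disoriented

namespace Disoriented
open Side Fast
variable {p q : ℕ} {k : Type*} [CommRing k] [Invertible (2 : k)] {ω : kˣ}

/-! ## Evaluation of formal linear combinations -/

open Classical in
/-- The morphism presented by polygons. -/
noncomputable def surface (k : Type*) [CommRing k] [Invertible (2 : k)] (ω : kˣ)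
    (X Y : GrTangle p q) (W : Polygons) : toDisAb k ω X ⟶ toDisAb k ω Y :=
  -- The value 0 for other lists of polygons makes surfaces total, so that formal sums carry no
  -- proofs; each evaluation lemma asks for validity where it matters.
  if h : Valid X Y W then ofCob k ω ⟨W, h.1, h.2⟩ else 0

theorem surface_eq {X Y : GrTangle p q} {W : Polygons} (h : Valid X Y W) :
    surface k ω X Y W = ofCob k ω ⟨W, h.1, h.2⟩ := dif_pos h

theorem surface_eq_ofCob {X Y : GrTangle p q} (S : Cob X Y) :
    surface k ω X Y S.polygons = ofCob k ω S := surface_eq ⟨S.isCobordism, S.degree⟩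

theorem ofCob_relation {X Y : GrTangle p q} {S : Cob X Y} {f} (h : Relations k ω p q (surf k S) f) :
    ofCob k ω S = (Quotient.functor (rel k ω p q)).map f :=
  CategoryTheory.Quotient.sound _ (LinearClosure.of h)

/-! ### The local relations for surfaces given by polygons. -/

section relations

variable {X Y Z : GrTangle p q} {W W' : Polygons}

theorem surface_congr (h : Valid X Y W) (h' : Valid X Y W') (H : Equivalent W W') :
    surface k ω X Y W = surface k ω X Y W' := by
  rw [surface_eq h, surface_eq h']
  exact ofCob_relation (Relations.homeo _ _ H)

/-- Validity of the glued surface is a hypothesis; it is tested for each product that occurs. -/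
theorem surface_comp (h : Valid X Y W) (h' : Valid Y Z W') (H : Valid X Z (glue W W')) :
    surface k ω X Y W ≫ surface k ω Y Z W' = surface k ω X Z (glue W W') := by
  rw [surface_eq h, surface_eq h', surface_eq H]
  exact ((CategoryTheory.Quotient.sound _ (LinearClosure.of
    (Relations.comp (k := k) (ω := ω) ⟨W, h.1, h.2⟩ ⟨W', h'.1, h'.2⟩ ⟨_, H.1, H.2⟩ rfl))))

theorem surface_one (h : Valid X X (cylinder X.tangle)) :
    surface k ω X X (cylinder X.tangle) = 𝟙 _ := by
  rw [surface_eq h]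
  exact (ofCob_relation (Relations.one _ rfl)).trans ((Quotient.functor (rel k ω p q)).map_id _)

theorem surface_sphere {x : ℕ} (h : Valid X Y ([fwd x, bwd x] :: W)) :
    surface k ω X Y ([fwd x, bwd x] :: W) = 0 := by
  rw [surface_eq h]
  exact ofCob_relation (Relations.sphere _ x W rfl)

theorem surface_neck {x y : ℕ} {u v : List Side} (hu : u ≠ []) (hv : v ≠ [])
    (h : Valid X Y (Neck.polygons (x, u, v, W)))
    (h₁ : Valid X Y ((u ++ handle x y) :: v :: W)) (h₂ : Valid X Y (u :: (v ++ handle x y) :: W)) :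
    (2 : k) • surface k ω X Y (Neck.polygons (x, u, v, W)) =
      surface k ω X Y ((u ++ handle x y) :: v :: W) +
        surface k ω X Y (u :: (v ++ handle x y) :: W) := by
  rw [surface_eq h, surface_eq h₁, surface_eq h₂]
  have H : ofCob k ω (⟨_, h.1, h.2⟩ : Cob X Y) =
      ⅟(2 : k) • (ofCob k ω (⟨_, h₁.1, h₁.2⟩ : Cob X Y) + ofCob k ω (⟨_, h₂.1, h₂.2⟩ : Cob X Y)) :=
    ofCob_relation (Relations.neck _ ⟨_, h₁.1, h₁.2⟩ ⟨_, h₂.1, h₂.2⟩ x y u v W hu hv rfl rfl rfl)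
  rw [H, smul_smul, mul_invOf_self, one_smul]

theorem surface_inward {x y : ℕ} (h : Valid X Y ([head y] :: W))
    (h' : Valid X Y ([bwd x] :: W.map (List.map (Side.unseam y x)))) :
    surface k ω X Y ([head y] :: W) =
      (ω : k) • surface k ω X Y ([bwd x] :: W.map (List.map (Side.unseam y x))) := by
  rw [surface_eq h, surface_eq h']
  exact ofCob_relation (Relations.inward _ ⟨_, h'.1, h'.2⟩ x y W rfl rfl)

theorem surface_outward {x y : ℕ} (h : Valid X Y ([tail y] :: W))
    (h' : Valid X Y ([bwd x] :: W.map (List.map (Side.unseam y x)))) :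
    surface k ω X Y ([tail y] :: W) =
      ((ω⁻¹ : kˣ) : k) • surface k ω X Y ([bwd x] :: W.map (List.map (Side.unseam y x))) := by
  rw [surface_eq h, surface_eq h']
  exact ofCob_relation (Relations.outward _ ⟨_, h'.1, h'.2⟩ x y W rfl rfl)

theorem surface_parallel {y₁ y₂ a₁ a₂ x₁ x₂ z₁ z₂ : ℕ}
    (h : Valid X Y ([head y₁, fwd a₁, head y₂, fwd a₂] :: W))
    (h' : Valid X Y ([tail z₂, bwd x₂, tail z₁, bwd x₁] ::
      W.map (List.map (Side.recouple y₁ y₂ a₁ a₂ x₁ x₂ z₁ z₂)))) :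
    surface k ω X Y ([head y₁, fwd a₁, head y₂, fwd a₂] :: W) =
      ((ω⁻¹ : kˣ) : k) • surface k ω X Y ([tail z₂, bwd x₂, tail z₁, bwd x₁] ::
        W.map (List.map (Side.recouple y₁ y₂ a₁ a₂ x₁ x₂ z₁ z₂))) := by
  rw [surface_eq h, surface_eq h']
  exact ofCob_relation (Relations.parallel _ ⟨_, h'.1, h'.2⟩ y₁ y₂ a₁ a₂ x₁ x₂ z₁ z₂ W rfl rfl)

end relations
end Disoriented

namespace Disoriented
open Side Fast
/-! ## Vanishing of formal linear combinations -/

theorem omega_pow_mod {k : Type*} [CommRing k] {ω : kˣ} (hω : (ω : k) ^ 4 = 1) (n : ℕ) :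
    (ω : k) ^ (n % 4) = (ω : k) ^ n := by
  conv_rhs => rw [← Nat.div_add_mod n 4, pow_add, pow_mul, hω, one_pow, one_mul]

theorem omega_inv {k : Type*} [CommRing k] {ω : kˣ} (hω : (ω : k) ^ 4 = 1) :
    ((ω⁻¹ : kˣ) : k) = (ω : k) ^ 3 := by
  have : (ω : k) ^ 3 * ω = 1 := by rw [← pow_succ]; exact hω
  rw [← Units.mul_left_inj ω, this, Units.inv_mul]

variable {p q : ℕ} {k : Type*} [CommRing k] [Invertible (2 : k)] {ω : kˣ}

section evaluation

variable {X Y : GrTangle p q}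

/-- The morphism given by a term of a formal linear combination. -/
noncomputable def termEval (k : Type*) [CommRing k] [Invertible (2 : k)] (ω : kˣ)
    (X Y : GrTangle p q) (t : ℤ × ℕ × Polygons) : toDisAb k ω X ⟶ toDisAb k ω Y :=
  ((t.1 : k) * (ω : k) ^ t.2.1) • surface k ω X Y t.2.2

/-- The morphism given by a formal linear combination. -/
noncomputable def Comb.eval (k : Type*) [CommRing k] [Invertible (2 : k)] (ω : kˣ)
    (X Y : GrTangle p q) (C : Comb) : toDisAb k ω X ⟶ toDisAb k ω Y :=
  (C.map (termEval k ω X Y)).sum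

@[simp] theorem Comb.eval_nil : Comb.eval k ω X Y [] = 0 := rfl

@[simp] theorem Comb.eval_cons (t : ℤ × ℕ × Polygons) (C : Comb) :
    Comb.eval k ω X Y (t :: C) = termEval k ω X Y t + Comb.eval k ω X Y C := rfl

@[simp] theorem Comb.eval_append (C D : Comb) :
    Comb.eval k ω X Y (C ++ D) = Comb.eval k ω X Y C + Comb.eval k ω X Y D := by
  rw [Comb.eval, List.map_append, List.sum_append]; rfl

theorem Comb.eval_singleton (t : ℤ × ℕ × Polygons) :
    Comb.eval k ω X Y [t] = termEval k ω X Y t := by simp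

theorem Comb.eval_neg (C : Comb) : Comb.eval k ω X Y C.neg = -Comb.eval k ω X Y C := by
  induction C with
  | nil => simp [Comb.neg]
  | cons t C ih =>
    have : Comb.neg (t :: C) = (-t.1, t.2) :: Comb.neg C := rfl
    rw [this, Comb.eval_cons, ih, Comb.eval_cons, neg_add]
    congr 1
    simp [termEval]

/-- Applied with factor 1 to rewriting steps and with factor 2 to neck cutting and doubling. -/
theorem Comb.eval_flatMap {a : k} {C : Comb} {f : ℤ × ℕ × Polygons → Comb}
    (h : ∀ t ∈ C, Comb.eval k ω X Y (f t) = a • termEval k ω X Y t) :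
    Comb.eval k ω X Y (C.flatMap f) = a • Comb.eval k ω X Y C := by
  induction C with
  | nil => simp
  | cons t C ih =>
    rw [List.flatMap_cons, Comb.eval_append, Comb.eval_cons, smul_add, h t List.mem_cons_self,
      ih fun t ht => h t (List.mem_cons_of_mem _ ht)]

theorem termEval_two_mul (t : ℤ × ℕ × Polygons) :
    termEval k ω X Y (2 * t.1, t.2) = (2 : k) • termEval k ω X Y t := by
  simp [termEval, smul_smul, mul_assoc]

/-- Terms with the same polygons and the same exponent modulo 4 are collected. Their integer
coefficients sum to 0 already in ℤ, hence in every `k`. -/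
theorem eval_eq_zero_of_cancels (hω : (ω : k) ^ 4 = 1) (m : ℕ) (C : Comb)
    (h : cancels m C = true) : Comb.eval k ω X Y C = 0 := by
  have split : ∀ (P : ℤ × ℕ × Polygons → Bool) (C : Comb), Comb.eval k ω X Y C =
      Comb.eval k ω X Y (C.filter P) + Comb.eval k ω X Y (C.filter fun s => !P s) := by
    intro P C
    induction C with
    | nil => simp
    | cons t C ih =>
      rcases hP : P t with _ | _
      · rw [List.filter_cons_of_neg (by simp [hP]), List.filter_cons_of_pos (by simp [hP])]
        simp only [Comb.eval_cons, ih]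
        abel
      · rw [List.filter_cons_of_pos (by simp [hP]), List.filter_cons_of_neg (by simp [hP])]
        simp only [Comb.eval_cons, ih]
        abel
  have same : ∀ (n : ℕ) (W : Polygons) (C : Comb),
      (∀ s ∈ C, s.2.1 % 4 = n % 4 ∧ s.2.2 = W) →
      Comb.eval k ω X Y C =
        (((C.map Prod.fst).sum : ℤ) : k) • ((ω : k) ^ (n % 4) • surface k ω X Y W) := by
    intro n W C
    induction C with
    | nil => simp
    | cons t C ih =>
      intro hC
      rw [Comb.eval_cons, ih fun s hs => hC s (List.mem_cons_of_mem _ hs), List.map_cons,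
        List.sum_cons, Int.cast_add, add_smul]
      congr 1
      obtain ⟨h1, h2⟩ := hC t List.mem_cons_self
      rw [termEval, h2, ← omega_pow_mod hω t.2.1, h1, smul_smul]
  induction m generalizing C with
  | zero =>
    cases C with
    | nil => rfl
    | cons t C => simp [cancels] at h
  | succ m ih =>
    cases C with
    | nil => rfl
    | cons t C =>
      simp only [cancels, Bool.and_eq_true, decide_eq_true_iff] at h
      obtain ⟨h1, h2⟩ := h
      rw [split (fun s => decide (s.2.1 % 4 = t.2.1 % 4 ∧ s.2.2 = t.2.2))]
      rw [same t.2.1 t.2.2 _ fun s hs => by simpa using (List.mem_filter.1 hs).2, h1]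
      rw [List.filter_cons_of_neg (by simp), ih _ h2]
      simp

/-! ### Soundness of rewriting and neck cutting. -/

/-- The surfaces of a rewriting rule agree up to the given power of `ω`. -/
theorem removeDisc_spec (hω : (ω : k) ^ 4 = 1) {W : Polygons} {r : Rewrite}
    (h : removeDisc W = some r) (h₁ : Valid X Y r.1) (h₂ : Valid X Y r.2.1) :
    surface k ω X Y r.1 = (ω : k) ^ r.2.2 • surface k ω X Y r.2.1 := by
  rw [removeDisc] at h
  dsimp only at h
  split at h
  · simp only [Option.some.injEq] at h
    subst h
    rw [surface_inward h₁ h₂, pow_one]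
  · simp only [Option.some.injEq] at h
    subst h
    rw [surface_outward h₁ h₂, omega_inv hω]
  · simp at h

theorem recoupleFirst_spec (hω : (ω : k) ^ 4 = 1) {κ : SeamSide} {W : Polygons} {r : Rewrite}
    (h : recoupleFirst κ W = some r) (h₁ : Valid X Y r.1) (h₂ : Valid X Y r.2.1) :
    surface k ω X Y r.1 = (ω : k) ^ r.2.2 • surface k ω X Y r.2.1 := by
  simp only [recoupleFirst, Option.bind_eq_bind, Option.bind_eq_some_iff] at h
  obtain ⟨w, -, s, -, s', -, ⟨t, R⟩, -, h⟩ := h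
  split at h
  · simp only [Option.some.injEq] at h
    subst h
    rw [surface_parallel h₁ h₂, omega_inv hω]
  · simp only [Option.some.injEq] at h
    subst h
    -- The relation expresses the new surface as ω⁻¹ times the given one, so the given one is ω
    -- times the new one.
    rw [surface_parallel h₂ h₁, smul_smul, pow_one, Units.mul_inv, one_smul]
  · simp at h

/-- Each step replaces the surface by an equivalent one or applies one local relation; in all other
branches the term is returned. Validity is carried along because the next simplification starts from
these terms. -/
theorem reduce_spec (hω : (ω : k) ^ 4 = 1) (κ : Option SeamSide) (m : ℕ) (t : ℤ × ℕ × Polygons)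
    (ht : Valid X Y t.2.2) :
    Comb.eval k ω X Y (reduce X Y κ m t) = termEval k ω X Y t ∧
      ∀ s ∈ reduce X Y κ m t, Valid X Y s.2.2 := by
  induction m generalizing t with
  | zero => simp [reduce, ht]
  | succ m ih =>
    obtain ⟨c, n, W₀⟩ := t
    rw [reduce]
    split_ifs with hW
    swap
    · simp_all
    have hW := valid_of_validTest hW
    have h0 : termEval k ω X Y (c, n, W₀) = termEval k ω X Y (c, n, normalize W₀) := by
      simp only [termEval]
      rw [surface_congr ht hW (normalize_equivalent W₀)]
    rw [h0]
    have done : Comb.eval k ω X Y [(c, n, normalize W₀)] = termEval k ω X Y (c, n, normalize W₀) ∧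
        ∀ s ∈ [(c, n, normalize W₀)], Valid X Y s.2.2 :=
      ⟨Comb.eval_singleton _, by simpa using hW⟩
    generalize normalize W₀ = W at hW done
    split
    · rename_i x hx
      split_ifs with hs
      · have hx : [fwd x, bwd x] ∈ W := by simpa using List.find?_some hx
        have hs := valid_of_validTest hs
        rw [termEval, surface_congr hW hs (Equivalent.of_perm (List.perm_cons_erase hx)),
          surface_sphere hs]
        simp
      · exact done
    · split
      · exact done
      · rename_i S T e hr
        split_ifs with h
        · obtain ⟨h1, h2, h3⟩ := h
          have h2 := valid_of_validTest h2
          have h3 := valid_of_validTest h3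
          have h4 : surface k ω X Y S = (ω : k) ^ e • surface k ω X Y T := by
            rcases hd : removeDisc W with _ | r
            · rw [hd, Option.orElse_none, Option.bind_eq_some_iff] at hr
              obtain ⟨κ, -, hκ⟩ := hr
              exact recoupleFirst_spec hω hκ h2 h3
            · rw [hd, Option.orElse_some, Option.some.injEq] at hr
              subst hr
              exact removeDisc_spec hω hd h2 h3
          obtain ⟨h5, h6⟩ := ih (c, (n + e) % 4, T) h3
          refine ⟨h5.trans ?_, h6⟩
          have h7 : Equivalent S W := h1 ▸ normalize_equivalent S
          rw [termEval, termEval, ← surface_congr h2 hW h7, h4, smul_smul]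
          dsimp only
          rw [omega_pow_mod hω, pow_add, mul_assoc]
        · exact done

theorem cutNeck_spec (κ : SeamSide) (t : ℤ × ℕ × Polygons) (ht : Valid X Y t.2.2) :
    Comb.eval k ω X Y (cutNeck X Y κ t) = (2 : k) • termEval k ω X Y t ∧
      ∀ s ∈ cutNeck X Y κ t, Valid X Y s.2.2 := by
  have done : Comb.eval k ω X Y [(2 * t.1, t.2)] = (2 : k) • termEval k ω X Y t ∧
      ∀ s ∈ [((2 * t.1, t.2) : ℤ × ℕ × Polygons)], Valid X Y s.2.2 :=
    ⟨by rw [Comb.eval_singleton, termEval_two_mul], by simpa using ht⟩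
  rw [cutNeck]
  split
  · exact done
  rename_i N hN
  simp only
  split_ifs with h
  · obtain ⟨hu, hv, h1, h2, h3⟩ := h
    have h1 := valid_of_validTest h1
    have h2 := valid_of_validTest h2
    have h3 := valid_of_validTest h3
    -- The preference for certain necks is irrelevant here: whichever is chosen, it comes from the
    -- list of necks of the surface.
    have h4 : ∃ x, neckAt t.2.2 x = some N := by
      rw [findNeck] at hN
      have mem : ∀ N ∈ (labels edgeLabel t.2.2).filterMap (neckAt t.2.2),
          ∃ x, neckAt t.2.2 x = some N := by
        intro N hN
        obtain ⟨x, -, hx⟩ := List.mem_filterMap.1 hN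
        exact ⟨x, hx⟩
      revert hN
      generalize hf : List.find? _ _ = o
      intro hN
      rcases o with _ | N'
      · exact mem N (List.mem_of_mem_head? hN)
      · rw [Option.orElse_some, Option.some.injEq] at hN
        subst hN
        exact mem _ (List.mem_of_find?_eq_some hf)
    obtain ⟨x, hx⟩ := h4
    refine ⟨?_, ?_⟩
    · have h5 := surface_neck (k := k) (ω := ω) hu hv h1 h2 h3
      rw [Comb.eval_cons, Comb.eval_singleton, termEval, termEval, termEval, smul_comm,
        surface_congr ht h1 (neckAt_equivalent hx), ← smul_add]
      exact congrArg _ h5.symm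
    · simp only [List.mem_cons, List.not_mem_nil, or_false]
      rintro s (rfl | rfl)
      · exact h2
      · exact h3
  · exact done

theorem expand_spec (hω : (ω : k) ^ 4 = 1) (μ : Mode) (t : ℤ × ℕ × Polygons)
    (ht : Valid X Y t.2.2) :
    Comb.eval k ω X Y (expand X Y μ t) = (2 : k) • termEval k ω X Y t := by
  have generic : ∀ κ : Option SeamSide,
      Comb.eval k ω X Y ((reduce X Y κ 12 t).map fun t => (2 * t.1, t.2)) =
        (2 : k) • termEval k ω X Y t := by
    intro κ
    rw [← (reduce_spec hω κ 12 t ht).1, List.map_eq_flatMap]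
    refine Comb.eval_flatMap fun s _ => ?_
    rw [Comb.eval_singleton, termEval_two_mul]
  rcases μ with _ | ⟨κ, _ | _⟩
  · exact generic none
  · exact generic (some κ)
  · obtain ⟨h1, h2⟩ := reduce_spec hω (some κ) 12 t ht
    have h3 := fun s hs => cutNeck_spec (k := k) (ω := ω) κ s (h2 s hs)
    have h4 : ∀ s ∈ (reduce X Y (some κ) 12 t).flatMap (cutNeck X Y κ), Valid X Y s.2.2 := by
      intro s hs
      obtain ⟨s', hs', hs⟩ := List.mem_flatMap.1 hs
      exact (h3 s' hs').2 s hs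
    rw [expand, Comb.eval_flatMap (a := (1 : k)) fun s hs =>
      (reduce_spec hω none 12 s (h4 s hs)).1.trans (one_smul _ _).symm, one_smul,
      Comb.eval_flatMap fun s hs => (h3 s hs).1, h1]

/-- The computation shows that twice the combination is zero, and 2 is invertible. -/
theorem eval_eq_zero_of_vanishes (hω : (ω : k) ^ 4 = 1) {μ : Mode} {C : Comb}
    (h : vanishes X Y μ C = true) : Comb.eval k ω X Y C = 0 := by
  simp only [vanishes, Bool.and_eq_true, List.all_eq_true] at h
  obtain ⟨h1, h2⟩ := h
  have h3 := eval_eq_zero_of_cancels (X := X) (Y := Y) hω _ _ h2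
  rw [Comb.eval_flatMap fun t ht => expand_spec hω μ t (valid_of_validTest (h1 t ht))] at h3
  rw [← one_smul k (Comb.eval k ω X Y C), ← invOf_mul_self (2 : k), mul_smul, h3, smul_zero]

end evaluation
end Disoriented

namespace Disoriented
open Side Fast

/-! ## Matrices of formal linear combinations -/

/-- The sum of matrices. -/
def CombMat.add (A B : CombMat) : CombMat := fun v w => A v w ++ B v w

/-- The negative of a matrix. -/
def CombMat.neg (A : CombMat) : CombMat := fun v w => (A v w).neg

/-- The vertices of the cube of the initial tangle. -/
abbrev initialVertex : Resolution 3 → GrTangle 3 3 := initialTangle.vertex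

/-- The vertices of the cube of the final tangle. -/
abbrev finalVertex : Resolution 3 → GrTangle 3 3 := finalTangle.vertex

/-- Are all surfaces in the matrix cobordisms of degree `0` between the given objects? -/
noncomputable def CombMat.valid (X Y : Resolution 3 → GrTangle 3 3) (A : CombMat) : Bool :=
  vertices.all fun v => vertices.all fun w => (A v w).all fun t => validTest (X v) (Y w) t.2.2

/-- Does the matrix represent zero, the entries being simplified as indicated? -/
noncomputable def CombMat.vanishes (X Y : Resolution 3 → GrTangle 3 3)
    (μ : Resolution 3 → Resolution 3 → Mode) (A : CombMat) : Bool :=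
  vertices.all fun v => vertices.all fun w => Disoriented.vanishes (X v) (Y w) (μ v w) (A v w)

/-- The simplification showing that the chain map is compatible with the differentials. -/
def chainMode (v w : Resolution 3) : Mode :=
  match v 0, v 1, v 2, w 0, w 1, w 2 with
  -- Four composites lead from L100 to R101. Those through R100 and R001 split the circle off from
  -- other arcs, while those through L110 and L101 bound it by a separate disc; neck cutting makes
  -- them comparable.
  | true, false, false, true, false, true => some (.heads, true)
  | _, _, _, true, true, true => some (.tails, false)
  | _, _, _, _, _, _ => none

/-- The simplification showing that the homotopy inverse is compatible with the differentials. -/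
def inverseMode (v w : Resolution 3) : Mode :=
  match v 0, v 1, v 2, w 0, w 1, w 2 with
  -- The analogous entry R010 → L011, with composites through L010, L001, R110 and R011, the circle
  -- being that of L011.
  | false, true, false, false, true, true => some (.tails, true)
  | _, _, _, true, true, true => some (.tails, false)
  | _, _, _, _, _, _ => none

/-- The simplification for the first homotopy. -/
def initialMode (v w : Resolution 3) : Mode :=
  match v 0, v 1, v 2, w 0, w 1, w 2 with
  -- The identity of L011 contains the cylinder over the circle, which has to be compared with
  -- surfaces in which the circle is capped off.
  | false, true, true, false, true, true => some (.tails, true)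
  | true, true, true, true, true, true => some (.tails, false)
  | _, _, _, _, _, _ => none

/-- The simplification for the second homotopy. -/
def finalMode (v w : Resolution 3) : Mode :=
  match v 0, v 1, v 2, w 0, w 1, w 2 with
  | true, false, true, true, false, true => some (.heads, true)
  | true, true, true, true, true, true => some (.tails, false)
  | _, _, _, _, _, _ => none

/-! ### Kernel verification of the matrix identities. -/

set_option maxRecDepth 100000

theorem diffMat_initial_valid :
    (diffMat initialTangle).valid initialVertex initialVertex = true := by decide +kernel

theorem diffMat_final_valid :
    (diffMat finalTangle).valid finalVertex finalVertex = true := by decide +kernel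

theorem r3Mat_valid : r3Mat.valid initialVertex finalVertex = true := by decide +kernel

theorem r3InvMat_valid : r3InvMat.valid finalVertex initialVertex = true := by decide +kernel

theorem initialHomotopy_valid :
    initialHomotopy.valid initialVertex initialVertex = true := by decide +kernel

theorem finalHomotopy_valid :
    finalHomotopy.valid finalVertex finalVertex = true := by decide +kernel

/-- Saddles at different crossings commute: the two orders give surfaces with the same normal form,
and their signs are opposite. -/
theorem initial_sq_vanishes :
    ((diffMat initialTangle).mul (diffMat initialTangle)).vanishes initialVertex initialVertex
      (fun _ _ => none) = true := by decide +kernel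

theorem final_sq_vanishes :
    ((diffMat finalTangle).mul (diffMat finalTangle)).vanishes finalVertex finalVertex
      (fun _ _ => none) = true := by decide +kernel

theorem r3Mat_comm_vanishes :
    (((diffMat initialTangle).mul r3Mat).add (r3Mat.mul (diffMat finalTangle)).neg).vanishes
      initialVertex finalVertex chainMode = true := by decide +kernel

theorem r3InvMat_comm_vanishes :
    (((diffMat finalTangle).mul r3InvMat).add (r3InvMat.mul (diffMat initialTangle)).neg).vanishes
      finalVertex initialVertex inverseMode = true := by decide +kernel

theorem initial_homotopy_vanishes :
    (((r3Mat.mul r3InvMat).add (((diffMat initialTangle).mul initialHomotopy).add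
      (initialHomotopy.mul (diffMat initialTangle)))).add (oneMat initialTangle).neg).vanishes
      initialVertex initialVertex initialMode = true := by decide +kernel

theorem final_homotopy_vanishes :
    (((r3InvMat.mul r3Mat).add (((diffMat finalTangle).mul finalHomotopy).add
      (finalHomotopy.mul (diffMat finalTangle)))).add (oneMat finalTangle).neg).vanishes
      finalVertex finalVertex finalMode = true := by decide +kernel

end Disoriented

namespace Disoriented
open Side Fast
variable {k : Type*} [CommRing k] [Invertible (2 : k)] {ω : kˣ}

/-! ## Evaluation of matrices -/

section matrices

variable {X Y Z : Resolution 3 → GrTangle 3 3}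

/-- All surfaces in the matrix are cobordisms of degree `0` between the given objects. -/
def CombMat.IsValid (X Y : Resolution 3 → GrTangle 3 3) (A : CombMat) : Prop :=
  ∀ v w, ∀ t ∈ A v w, Valid (X v) (Y w) t.2.2

/-- The matrix raises the weight by `d`. -/
def CombMat.HasDegree (A : CombMat) (d : ℤ) : Prop :=
  ∀ v w : Resolution 3, A v w = [] ∨ (w.weight : ℤ) = v.weight + d

theorem mem_vertices (v : Resolution 3) : v ∈ vertices := by
  revert v
  decide

theorem sum_vertices {M : Type*} [AddCommMonoid M] (f : Resolution 3 → M) :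
    (vertices.map f).sum = ∑ v, f v := by
  have h : (Finset.univ : Finset (Resolution 3)) = vertices.toFinset := by
    ext v
    simp [mem_vertices v]
  rw [h, List.sum_toFinset f (by decide)]

theorem CombMat.isValid_of_valid {A : CombMat} (h : A.valid X Y = true) : A.IsValid X Y := by
  intro v w t ht
  simp only [CombMat.valid, List.all_eq_true] at h
  exact valid_of_validTest (h v (mem_vertices v) w (mem_vertices w) t ht)

/-- The vanishing test also checks every term it is given, including all glued surfaces. This
supplies the validity of products needed for `CombMat.eval_mul`. -/
theorem CombMat.isValid_of_vanishes {A : CombMat} {μ : Resolution 3 → Resolution 3 → Mode}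
    (h : A.vanishes X Y μ = true) : A.IsValid X Y := by
  intro v w t ht
  simp only [CombMat.vanishes, List.all_eq_true] at h
  have := h v (mem_vertices v) w (mem_vertices w)
  simp only [Disoriented.vanishes, Bool.and_eq_true, List.all_eq_true] at this
  exact valid_of_validTest (this.1 t ht)

theorem CombMat.IsValid.of_add_left {A B : CombMat} (h : (A.add B).IsValid X Y) :
    A.IsValid X Y := fun v w t ht => h v w t (List.mem_append_left _ ht)

theorem CombMat.IsValid.of_add_right {A B : CombMat} (h : (A.add B).IsValid X Y) :
    B.IsValid X Y := fun v w t ht => h v w t (List.mem_append_right _ ht)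

theorem CombMat.IsValid.of_neg {A : CombMat} (h : A.neg.IsValid X Y) : A.IsValid X Y :=
  fun v w t ht => h v w (-t.1, t.2) (List.mem_map_of_mem (f := fun t => (-t.1, t.2)) ht)

/-- The matrix of morphisms given by a matrix of formal linear combinations. -/
noncomputable def CombMat.eval (k : Type*) [CommRing k] [Invertible (2 : k)] (ω : kˣ)
    (X Y : Resolution 3 → GrTangle 3 3) (A : CombMat) (v w : Resolution 3) :
    toDisAb k ω (X v) ⟶ toDisAb k ω (Y w) :=
  Comb.eval k ω (X v) (Y w) (A v w)

theorem CombMat.eval_add (A B : CombMat) (v w : Resolution 3) :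
    (A.add B).eval k ω X Y v w = A.eval k ω X Y v w + B.eval k ω X Y v w :=
  Comb.eval_append _ _

theorem CombMat.eval_neg (A : CombMat) (v w : Resolution 3) :
    A.neg.eval k ω X Y v w = -A.eval k ω X Y v w :=
  Comb.eval_neg _

theorem CombMat.eval_eq_zero_of_vanishes (hω : (ω : k) ^ 4 = 1) {A : CombMat}
    {μ : Resolution 3 → Resolution 3 → Mode} (h : A.vanishes X Y μ = true) (v w : Resolution 3) :
    A.eval k ω X Y v w = 0 := by
  simp only [CombMat.vanishes, List.all_eq_true] at h
  exact Disoriented.eval_eq_zero_of_vanishes hω (h v (mem_vertices v) w (mem_vertices w))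

theorem Comb.eval_glue {p q : ℕ} {X Y Z : GrTangle p q} {C D : Comb}
    (hC : ∀ s ∈ C, Valid X Y s.2.2) (hD : ∀ t ∈ D, Valid Y Z t.2.2)
    (h : ∀ s ∈ C, ∀ t ∈ D, Valid X Z (glue s.2.2 t.2.2)) :
    Comb.eval k ω X Z (C.flatMap fun s => D.map fun t =>
      (s.1 * t.1, s.2.1 + t.2.1, glue s.2.2 t.2.2)) =
      Comb.eval k ω X Y C ≫ Comb.eval k ω Y Z D := by
  induction C with
  | nil => simp
  | cons s C ih =>
    rw [List.flatMap_cons, Comb.eval_append, Comb.eval_cons, Preadditive.add_comp,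
      ih (fun s hs => hC s (List.mem_cons_of_mem _ hs))
        (fun s hs => h s (List.mem_cons_of_mem _ hs))]
    congr 1
    clear ih
    induction D with
    | nil => simp
    | cons t D ih =>
      rw [List.map_cons, Comb.eval_cons, Comb.eval_cons, Preadditive.comp_add,
        ih (fun t ht => hD t (List.mem_cons_of_mem _ ht))
          (fun s hs t ht => h s hs t (List.mem_cons_of_mem _ ht))]
      congr 1
      simp only [termEval, Linear.smul_comp, Linear.comp_smul, smul_smul]
      rw [surface_comp (hC s List.mem_cons_self) (hD t List.mem_cons_self)
        (h s List.mem_cons_self t List.mem_cons_self)]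
      congr 1
      push_cast
      ring

theorem CombMat.eval_mul {A B : CombMat} (hA : A.IsValid X Y) (hB : B.IsValid Y Z)
    (h : (A.mul B).IsValid X Z) (v w : Resolution 3) :
    (A.mul B).eval k ω X Z v w = ∑ u, A.eval k ω X Y v u ≫ B.eval k ω Y Z u w := by
  have key : ∀ l : List (Resolution 3), (∀ u ∈ l, ∀ s ∈ A v u, ∀ t ∈ B u w,
      Valid (X v) (Z w) (glue s.2.2 t.2.2)) →
      Comb.eval k ω (X v) (Z w) (l.flatMap fun u => (A v u).flatMap fun s =>
        (B u w).map fun t => (s.1 * t.1, s.2.1 + t.2.1, glue s.2.2 t.2.2)) =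
      (l.map fun u => A.eval k ω X Y v u ≫ B.eval k ω Y Z u w).sum := by
    intro l
    induction l with
    | nil => intro _; rfl
    | cons u l ih =>
      intro hl
      rw [List.flatMap_cons, Comb.eval_append, List.map_cons, List.sum_cons,
        ih fun u hu => hl u (List.mem_cons_of_mem _ hu),
        Comb.eval_glue (hA v u) (hB u w) (hl u List.mem_cons_self)]
      rfl
  rw [← sum_vertices]
  refine key vertices fun u hu s hs t ht =>
    h v w (s.1 * t.1, s.2.1 + t.2.1, glue s.2.2 t.2.2) ?_
  exact List.mem_flatMap.2 ⟨u, hu, List.mem_flatMap.2 ⟨s, hs, List.mem_map.2 ⟨t, ht, rfl⟩⟩⟩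

theorem CombMat.HasDegree.eval_eq_zero {A : CombMat} {d : ℤ} (hA : A.HasDegree d)
    {v w : Resolution 3} (h : (w.weight : ℤ) ≠ v.weight + d) : A.eval k ω X Y v w = 0 := by
  rw [CombMat.eval, (hA v w).resolve_right h, Comb.eval_nil]

end matrices

theorem eval_diffMat {D : Diagram 3 3 3} (hD : D.SaddlesOK) (v w : Resolution 3) :
    (diffMat D).eval k ω D.vertex D.vertex v w = D.edgeMap k ω hD v w := by
  have key : ∀ l : List (Fin 3), Comb.eval k ω (D.vertex v) (D.vertex w) (l.flatMap fun c =>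
      if Diagram.IsEdge v w c then
        [((-1) ^ (Finset.univ.filter fun j => c < j ∧ v j).card, 0, D.saddlePolygons v c)]
      else []) =
      (l.map fun c => if h : Diagram.IsEdge v w c then
        ((-1 : k) ^ (Finset.univ.filter fun j => c < j ∧ v j).card) •
          ofCob k ω (Diagram.saddle hD h) else 0).sum := by
    intro l
    induction l with
    | nil => rfl
    | cons c l ih =>
      rw [List.flatMap_cons, Comb.eval_append, ih, List.map_cons, List.sum_cons]
      congr 1
      split_ifs with h
      · rw [Comb.eval_singleton, termEval, ← surface_eq_ofCob]
        simp [Diagram.saddle]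
      · rfl
  rw [CombMat.eval, diffMat, key, Diagram.edgeMap, ← List.ofFn_eq_map, List.sum_ofFn]

theorem eval_oneMat {D : Diagram 3 3 3} (hD : (oneMat D).IsValid D.vertex D.vertex)
    (v w : Resolution 3) : (oneMat D).eval k ω D.vertex D.vertex v w =
      if h : v = w then eqToHom (congrArg (fun v => toDisAb k ω (D.vertex v)) h) else 0 := by
  split_ifs with h
  · subst h
    have hv := hD v v (1, 0, cylinder (D.smoothing v)) (by simp [oneMat])
    have : termEval k ω (D.vertex v) (D.vertex v) (1, 0, cylinder (D.smoothing v)) = 𝟙 _ := by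
      rw [termEval]
      simp only [Int.cast_one, pow_zero, mul_one, one_smul]
      exact surface_one (X := D.vertex v) hv
    rw [CombMat.eval, oneMat, if_pos rfl, Comb.eval_singleton, this]
    rfl
  · rw [CombMat.eval, oneMat, if_neg h, Comb.eval_nil]

theorem eval_r3Mat (v w : Resolution 3) :
    r3Mat.eval k ω initialVertex finalVertex v w = r3Map k ω v w := by
  have coeff : ∀ W, Comb.eval k ω (initialVertex v) (finalVertex w)
      (match v 0, v 1, v 2, w 0, w 1, w 2 with
      | true, true, false, true, false, true => [(1, 2, W)]
      | true, false, true, true, false, true => [(-1, 2, W)]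
      | false, true, true, true, false, true => [(1, 2, W)]
      | true, false, true, false, true, true => [(-1, 0, W)]
      | _, _, _, _, _, _ => [(1, 0, W)]) =
      r3Coeff (ω : k) v w • surface k ω (initialVertex v) (finalVertex w) W := by
    intro W
    rw [r3Coeff]
    split <;> simp [termEval, *]
  rw [r3Map]
  split
  · rename_i W hW
    refine (congrArg (Comb.eval k ω _ _) (?_ : r3Mat v w = _)).trans ((coeff W).trans
      (congrArg _ (surface_eq_ofCob (X := initialVertex v)
      (Y := finalVertex w) ⟨W, (r3Polygons_ok v w W hW).1, (r3Polygons_ok v w W hW).2⟩)))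
    rw [r3Mat, hW]
  · rename_i hW
    rw [CombMat.eval, r3Mat, hW, Comb.eval_nil]

/-! ## Morphisms between the chain objects -/

section blocks

variable {D D' D'' : Diagram 3 3 3}

/-- The part of a matrix between vertices of given weights. -/
noncomputable def CombMat.block (k : Type*) [CommRing k] [Invertible (2 : k)] (ω : kˣ)
    (D D' : Diagram 3 3 3) (A : CombMat) (i j : ℤ) : D.chainObj k ω i ⟶ D'.chainObj k ω j :=
  fun v w => A.eval k ω D.vertex D'.vertex v.1 w.1

theorem CombMat.block_add (A B : CombMat) (i j : ℤ) :
    (A.add B).block k ω D D' i j = A.block k ω D D' i j + B.block k ω D D' i j := by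
  refine Mat_.hom_ext _ _ fun v w => ?_
  exact CombMat.eval_add A B v.1 w.1

theorem CombMat.block_neg (A : CombMat) (i j : ℤ) :
    A.neg.block k ω D D' i j = -A.block k ω D D' i j := by
  refine Mat_.hom_ext _ _ fun v w => ?_
  exact CombMat.eval_neg A v.1 w.1

theorem CombMat.block_eq_zero (hω : (ω : k) ^ 4 = 1) {A : CombMat}
    {μ : Resolution 3 → Resolution 3 → Mode} (h : A.vanishes D.vertex D'.vertex μ = true)
    (i j : ℤ) : A.block k ω D D' i j = 0 := by
  refine Mat_.hom_ext _ _ fun v w => ?_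
  exact CombMat.eval_eq_zero_of_vanishes hω h v.1 w.1

theorem CombMat.HasDegree.block_eq_zero {A : CombMat} {d : ℤ} (hA : A.HasDegree d) {i j : ℤ}
    (h : j ≠ i + d) : A.block k ω D D' i j = 0 := by
  refine Mat_.hom_ext _ _ fun v w => ?_
  refine hA.eval_eq_zero ?_
  rw [v.2, w.2]
  exact h

/-- The matrix product runs over all eight vertices, the composition only over those of weight `j`.
The degree of `A` makes the other summands vanish. -/
theorem CombMat.block_mul {A B : CombMat} (hA : A.IsValid D.vertex D'.vertex)
    (hB : B.IsValid D'.vertex D''.vertex) (h : (A.mul B).IsValid D.vertex D''.vertex) {d : ℤ}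
    (hd : A.HasDegree d) {i j : ℤ} (hj : j = i + d) (l : ℤ) :
    (A.mul B).block k ω D D'' i l = A.block k ω D D' i j ≫ B.block k ω D' D'' j l := by
  refine Mat_.hom_ext _ _ fun v w => ?_
  rw [Mat_.comp_apply]
  refine (CombMat.eval_mul hA hB h v.1 w.1).trans ?_
  have h0 : ∀ u : Resolution 3, u ∈ Finset.univ → A.eval k ω D.vertex D'.vertex v.1 u ≫
      B.eval k ω D'.vertex D''.vertex u w.1 ≠ 0 → (u.weight : ℤ) = j := by
    intro u _ hu
    by_contra hw
    refine hu ?_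
    rw [hd.eval_eq_zero (by rw [v.2, ← hj]; exact hw), Limits.zero_comp]
  rw [← Finset.sum_filter_of_ne h0]
  exact Finset.sum_subtype _ (by simp) _

theorem block_diffMat (hD : D.SaddlesOK) (i j : ℤ) :
    (diffMat D).block k ω D D i j = Diagram.chainD k ω hD i j := by
  refine Mat_.hom_ext _ _ fun v w => ?_
  exact eval_diffMat hD v.1 w.1

theorem block_oneMat (hD : (oneMat D).IsValid D.vertex D.vertex) (i : ℤ) :
    (oneMat D).block k ω D D i i = 𝟙 _ := by
  refine Mat_.hom_ext _ _ fun v w => ?_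
  rw [Mat_.id_apply]
  refine (eval_oneMat hD v.1 w.1).trans ?_
  by_cases h : v = w
  · subst h
    rw [dif_pos rfl, dif_pos rfl]
    rfl
  · rw [dif_neg fun h' => h (Subtype.ext h'), dif_neg h]
    rfl

end blocks

/-! ### The degrees of the explicit matrices. -/

theorem diffMat_initial_hasDegree : (diffMat initialTangle).HasDegree 1 := by
  unfold CombMat.HasDegree
  decide +kernel

theorem diffMat_final_hasDegree : (diffMat finalTangle).HasDegree 1 := by
  unfold CombMat.HasDegree
  decide +kernel

theorem r3Mat_hasDegree : r3Mat.HasDegree 0 := by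
  unfold CombMat.HasDegree
  decide +kernel

theorem r3InvMat_hasDegree : r3InvMat.HasDegree 0 := by
  unfold CombMat.HasDegree
  decide +kernel

theorem initialHomotopy_hasDegree : initialHomotopy.HasDegree (-1) := by
  unfold CombMat.HasDegree
  decide +kernel

theorem finalHomotopy_hasDegree : finalHomotopy.HasDegree (-1) := by
  unfold CombMat.HasDegree
  decide +kernel

end Disoriented

namespace Disoriented
variable {k : Type*} [CommRing k] [Invertible (2 : k)] {ω : kˣ}

/-! ## The complexes and the homotopy equivalence -/

section complexes

variable {D D' : Diagram 3 3 3}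

theorem squareZero_of_vanishes (hω : (ω : k) ^ 4 = 1) (hD : D.SaddlesOK)
    (hd : (diffMat D).HasDegree 1) (hv : (diffMat D).IsValid D.vertex D.vertex)
    {μ : Resolution 3 → Resolution 3 → Mode}
    (h : ((diffMat D).mul (diffMat D)).vanishes D.vertex D.vertex μ = true) :
    Diagram.SquareZero k ω hD := by
  intro i
  rw [← block_diffMat, ← block_diffMat,
    ← CombMat.block_mul hv hv (CombMat.isValid_of_vanishes h) hd rfl]
  exact CombMat.block_eq_zero hω h _ _

/-- The chain map given by a matrix which is compatible with the differentials. -/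
noncomputable def chainMap (hω : (ω : k) ^ 4 = 1) (hD : D.SaddlesOK) (hD' : D'.SaddlesOK)
    (h0 : Diagram.SquareZero k ω hD) (h0' : Diagram.SquareZero k ω hD')
    (hd : (diffMat D).HasDegree 1) (hv : (diffMat D).IsValid D.vertex D.vertex)
    (hv' : (diffMat D').IsValid D'.vertex D'.vertex)
    {A : CombMat} (hA : A.HasDegree 0) (hAv : A.IsValid D.vertex D'.vertex)
    {μ : Resolution 3 → Resolution 3 → Mode}
    (h : (((diffMat D).mul A).add (A.mul (diffMat D')).neg).vanishes D.vertex D'.vertex μ = true) :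
    Diagram.complex k ω hD h0 ⟶ Diagram.complex k ω hD' h0' where
  f i := A.block k ω D D' i i
  comm' i j hij := by
    obtain rfl : i + 1 = j := hij
    change A.block k ω D D' i i ≫ Diagram.chainD k ω hD' i (i + 1) =
      Diagram.chainD k ω hD i (i + 1) ≫ A.block k ω D D' (i + 1) (i + 1)
    have hs := CombMat.isValid_of_vanishes h
    have := CombMat.block_eq_zero (ω := ω) hω h i (i + 1)
    rw [CombMat.block_add, CombMat.block_neg,
      CombMat.block_mul hv hAv hs.of_add_left hd rfl,
      CombMat.block_mul hAv hv' hs.of_add_right.of_neg hA (add_zero i).symm,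
      add_neg_eq_zero, block_diffMat hD, block_diffMat hD'] at this
    exact this.symm

/-- The homotopy given by a matrix which lowers the weight. -/
noncomputable def homotopyOfVanishes (hω : (ω : k) ^ 4 = 1) (hD : D.SaddlesOK)
    (h0 : Diagram.SquareZero k ω hD)
    (hd : (diffMat D).HasDegree 1) (hv : (diffMat D).IsValid D.vertex D.vertex)
    {A B C : CombMat} (hA : A.HasDegree 0) (hAv : A.IsValid D.vertex D'.vertex)
    (hBv : B.IsValid D'.vertex D.vertex) (hC : C.HasDegree (-1)) (hCv : C.IsValid D.vertex D.vertex)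
    {μ : Resolution 3 → Resolution 3 → Mode}
    (h : (((A.mul B).add (((diffMat D).mul C).add (C.mul (diffMat D)))).add
      (oneMat D).neg).vanishes D.vertex D.vertex μ = true)
    (F : Diagram.complex k ω hD h0 ⟶ Diagram.complex k ω hD h0)
    (hF : ∀ i, F.f i = A.block k ω D D' i i ≫ B.block k ω D' D i i) :
    Homotopy F (𝟙 _) where
  -- The verified identity is AB + dC + Cd = 1, whereas a homotopy to the identity requires AB = dh
  -- + hd + 1; hence h = -C.
  hom i j := -C.block k ω D D i j
  zero i j hij := by
    have : i ≠ j + 1 := fun h => hij h.symm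
    rw [hC.block_eq_zero (by omega), neg_zero]
    rfl
  comm i := by
    have hs := CombMat.isValid_of_vanishes h
    have := CombMat.block_eq_zero (ω := ω) hω h i i
    rw [CombMat.block_add, CombMat.block_neg, CombMat.block_add, CombMat.block_add,
      CombMat.block_mul hAv hBv hs.of_add_left.of_add_left hA (add_zero i).symm,
      CombMat.block_mul hv hCv hs.of_add_left.of_add_right.of_add_left hd (rfl : i + 1 = _),
      CombMat.block_mul hCv hv hs.of_add_left.of_add_right.of_add_right hC (rfl : i + -1 = _),
      block_oneMat hs.of_add_right.of_neg, add_neg_eq_zero, block_diffMat hD, block_diffMat hD]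
      at this
    have hn := dNext_eq (C := Diagram.complex k ω hD h0) (D := Diagram.complex k ω hD h0)
      (fun i j => -C.block k ω D D i j) (rfl : i + 1 = i + 1)
    have hp := prevD_eq (C := Diagram.complex k ω hD h0) (D := Diagram.complex k ω hD h0)
      (fun i j => -C.block k ω D D i j)
      (show (ComplexShape.up ℤ).Rel (i + -1) i from Int.neg_add_cancel_right i 1)
    refine (hF i).trans (Eq.trans ?_ (congrArg₂ (· + ·) (congrArg₂ (· + ·) hn hp) rfl).symm)
    change _ = Diagram.chainD k ω hD i (i + 1) ≫ (-C.block k ω D D (i + 1) i) +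
      (-C.block k ω D D i (i + -1)) ≫ Diagram.chainD k ω hD (i + -1) i + 𝟙 (D.chainObj k ω i)
    rw [Preadditive.comp_neg, Preadditive.neg_comp, ← this]
    abel

end complexes

/-- The chain map of the Reidemeister move is a homotopy equivalence. -/
theorem exists_homotopyEquiv_r3Map {k : Type*} [CommRing k] [Invertible (2 : k)] (ω : kˣ)
    (hω : (ω : k) ^ 2 = -1 ∨ ω = 1) :
    ∃ (hL : Diagram.SquareZero k ω initialTangle_ok)
      (hR : Diagram.SquareZero k ω finalTangle_ok)
      (F : HomotopyEquiv
        (Diagram.complex k ω initialTangle_ok hL)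
        (Diagram.complex k ω finalTangle_ok hR)),
      ∀ (i : ℤ) (v w : {v : Resolution 3 // (v.weight : ℤ) = i}),
        F.hom.f i v w = r3Map k ω v.1 w.1 := by
  -- This is the only point where the two cases for ω are distinguished; everything else is computed
  -- from ω⁴ = 1.
  have h4 : (ω : k) ^ 4 = 1 := by
    rcases hω with h | rfl
    · rw [show 4 = 2 * 2 from rfl, pow_mul, h, neg_one_sq]
    · simp
  have vL := CombMat.isValid_of_valid diffMat_initial_valid
  have vR := CombMat.isValid_of_valid diffMat_final_valid
  have vF := CombMat.isValid_of_valid r3Mat_valid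
  have vG := CombMat.isValid_of_valid r3InvMat_valid
  have hL := squareZero_of_vanishes h4 initialTangle_ok diffMat_initial_hasDegree vL
    initial_sq_vanishes
  have hR := squareZero_of_vanishes h4 finalTangle_ok diffMat_final_hasDegree vR
    final_sq_vanishes
  refine ⟨hL, hR, ⟨chainMap h4 _ _ hL hR diffMat_initial_hasDegree vL vR r3Mat_hasDegree vF
      r3Mat_comm_vanishes,
    chainMap h4 _ _ hR hL diffMat_final_hasDegree vR vL r3InvMat_hasDegree vG
      r3InvMat_comm_vanishes,
    homotopyOfVanishes h4 _ _ diffMat_initial_hasDegree vL r3Mat_hasDegree vF vG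
      initialHomotopy_hasDegree (CombMat.isValid_of_valid initialHomotopy_valid)
      initial_homotopy_vanishes _ fun _ => rfl,
    homotopyOfVanishes h4 _ _ diffMat_final_hasDegree vR r3InvMat_hasDegree vG vF
      finalHomotopy_hasDegree (CombMat.isValid_of_valid finalHomotopy_valid)
      final_homotopy_vanishes _ fun _ => rfl⟩, fun i v w => eval_r3Mat v.1 w.1⟩

end Disoriented

theorem proposition2p3 {k : Type*} [CommRing k] [Invertible (2 : k)] (ω : kˣ)
    (hω : (ω : k) ^ 2 = -1 ∨ ω = 1) :
    ∃ (hL : Disoriented.Diagram.SquareZero k ω Disoriented.initialTangle_ok)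
      (hR : Disoriented.Diagram.SquareZero k ω Disoriented.finalTangle_ok)
      (F : HomotopyEquiv
        (Disoriented.Diagram.complex k ω Disoriented.initialTangle_ok hL)
        (Disoriented.Diagram.complex k ω Disoriented.finalTangle_ok hR)),
      ∀ (i : ℤ) (v w : {v : Disoriented.Resolution 3 // (v.weight : ℤ) = i}),
        F.hom.f i v w = Disoriented.r3Map k ω v.1 w.1 := by
  exact Disoriented.exists_homotopyEquiv_r3Map ω hω
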